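/- **Setting.** An instance of the Submodular Prophet Inequality problem consists of days $\mathcal N=\{1,\dots,n\}$, independent random variables $X_i$ with distributions $\mathcal D_i$ on finite, pairwise disjoint sets $\mathcal U_i$, a downward-closed family $\mathcal I\ni\emptyset$ of feasible subsets of $\mathcal N$, and a non-negative submodular function $f$ on the subsets of $\mathcal U=\bigcup_i\mathcal U_i$. Let ${\rm OPT}=\mathbb E\big[\max_{T\in\mathcal I}f(\{X_i: i\in T\})\big]$, and for $e\in\mathcal U_i$ write $\mathcal D(e)=\mathcal D_i(e)$. Let $\mathcal P\subseteq[0,1]^n$ be a downward-closed polyhedral relaxation of $\mathcal I$ (a polyhedron containing the indicator vectors of all sets of $\mathcal I$), and $$\mathcal P''=\Big\{\mathbf y\in[0,1]^{\mathcal U}:\ \Big(\sum_{e\in\mathcal U_i}y_e\Big)_{i}\in\mathcal P,\ \ y_e\le\mathcal D(e)\ \ \forall e\in\mathcal U\Big\}.$$ *Greedy OCRS.* For a vector $\mathbf x$ with entries in $[0,1]$, $R\sim\mathbf x$ denotes the random set that contains each element $e$ independently with probability $x_e$. A (randomized) greedy OCRS $\pi$ for $\mathcal P$ draws, for each $\mathbf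 x\in\mathcal P$, a random non-empty down-closed family $\mathcal F_{\pi,\mathbf x}\subseteq\mathcal I$, and selects an arriving active element if and only if, together with the elements selected so far, it forms a set of $\mathcal F_{\pi,\mathbf x}$. For $b,c\in[0,1]$ it is $(b,c)$-selectable if for all $\mathbf x\in b\cdot\mathcal P$ and $i\in\mathcal N$, $\Pr[J\cup\{i\}\in\mathcal F_{\pi,\mathbf x}\ \ \forall J\subseteq R,\ J\in\mathcal F_{\pi,\mathbf x}]\ge c$, where $R\sim\mathbf x$ is independent of $\mathcal F_{\pi,\mathbf x}$. *Continuous greedy.* Let $F(\mathbf x)=\mathbb E_{R\sim\mathbf x}[f(R)]$. A run up to time $b$ with $N\ge1$ steps and accuracy $\delta$ starts at $\mathbf x^0=\mathbf 0$; in step $t$ it has estimates $w_e$ with $|w_e-\partial_eF(\mathbf x^t)|\le\delta f(\{e\})$ for all $e\in\mathcal U$, takes some $\mathbf v\in\mathcal P''$ that maximizes $\mathbf w\cdot\mathbf v$ over $\mathcal P''$, and sets $\mathbf x^{t+1}=\mathbf x^t+\frac bN\mathbf v$. Its output is $\mathbf z=\mathbf x^N$. *Algorithm 1* (input: $\mathbf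 z$). Let $\mathbf z_i$ be the restriction of $\mathbf z$ to $\mathcal U_i$, and give $\pi$ the vector $x_i=1-\prod_{e\in\mathcal U_i}(1-z_e)$. Start with $T_{\rm ALG}=\emptyset$. When $X_i$ arrives with realization $e$: with probability $\Pr_{R\sim\mathbf z_i}[R=\{e\}]/\mathcal D_i(e)$ set $T_i=\{e\}$; otherwise draw $T_i$ as $R\sim\mathbf z_i$ conditioned on $|R|\ne1$. If $T_i\neq\emptyset$, feed $i$ to $\pi$; if $\pi$ selects $i$ and $T_i=\{e\}$, add $e$ to $T_{\rm ALG}$. The almighty adversary chooses the order of arrival knowing all realizations and all random coins of the algorithm, those of $\pi$ included. *Splitting.* Given integers $k_e\ge1$ for $e\in\mathcal U$, the split instance replaces each $e$ by $k_e$ copies, each of probability $\mathcal D(e)/k_e$; its objective evaluates a set $A$ of copies as $f$ of the set of elements that have a copy in $A$. Days and $\mathcal I$ (and $\mathcal P$, $\pi$) are unchanged. An algorithm for the split instance is run on the original one by replacing each realization by a uniformly random copy, and returning the elements of the selected copies. **Theorem.** For every $\varepsilon>0$ there are $\varepsilon'>0$ and a function $\delta:\mathbb N\to(0,\infty)$,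 depending only on $\varepsilon$, such that the following holds for every Submodular Prophet Inequality instance with monotone non-negative submodular $f$, every downward-closed polyhedral relaxation $\mathcal P$ of $\mathcal I$, all $b,c\in[0,1]$, and every $(b,c)$-selectable greedy OCRS $\pi$ for $\mathcal P$. 1. Suppose $\mathcal D(e)\le\varepsilon'$ for all $e\in\mathcal U$, and let $\mathbf z$ be the output of any run of continuous greedy up to time $b$ with accuracy $\delta(|\mathcal U|)$ and $N\ge1/\delta(|\mathcal U|)$ steps. Then $\mathbf z\in b\cdot\mathcal P''$, the random choices of Algorithm 1 are well defined, Algorithm 1 always selects realized elements from a feasible set of days, and against every almighty adversary $$\mathbb E[f(T_{\rm ALG})]\ \ge\ c\,(e^{-b}-\varepsilon)(1-e^{-b})\cdot{\rm OPT}.$$ 2. Without any assumption on $\mathcal D$: for all integers $k_e\ge1$ with $\mathcal D(e)/k_e\le\varepsilon'$ for all $e\in\mathcal U$, let $\mathbf z$ be the output of continuous greedy on the split instance, with accuracy and number of steps as in 1 for the number of elements of the split instance. Then the statements of 1 hold for $\mathbf z$ (with $\mathcal P''$ taken for the split instance) and for Algorithm 1 for the split instance, run on the original instance; in particular the set $T_{\rm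 ALG}\subseteq\mathcal U$ that it returns satisfies the same bound, where ${\rm OPT}$ is that of the original instance. -/

import Mathlib

open scoped Pointwise

universe u

namespace SubmodularProphet

noncomputable section

/-! ### Set functions, product distributions and the multilinear extension -/

/-- A set function is submodular if `f (A ∪ B) + f (A ∩ B) ≤ f A + f B`. -/
def IsSubmodular {α : Type*} [DecidableEq α] (f : Finset α → ℝ) : Prop :=
  ∀ A B : Finset α, f (A ∪ B) + f (A ∩ B) ≤ f A + f B

/-- The probability that `R = S`, where the random set `R ∼ x` contains each `e` independently
with probability `x e`. -/
def prodProb {α : Type*} [Fintype α] [DecidableEq α] (x : α → ℝ) (S : Finset α) : ℝ :=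
  (∏ e ∈ S, x e) * ∏ e ∈ Sᶜ, (1 - x e)

/-- The multilinear extension `F x = E_{R ∼ x} [f R]`. -/
def multilinear {α : Type*} [Fintype α] [DecidableEq α] (f : Finset α → ℝ) (x : α → ℝ) : ℝ :=
  ∑ S : Finset α, prodProb x S * f S

/-- The partial derivative `∂F/∂x_e` at `x`. As `F` is affine in each coordinate, it is the
difference of the values of `F` at `x_e = 1` and at `x_e = 0`. -/
def multilinearGrad {α : Type*} [Fintype α] [DecidableEq α] (f : Finset α → ℝ) (x : α → ℝ)
    (e : α) : ℝ :=
  multilinear f (Function.update x e 1) - multilinear f (Function.update x e 0)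

/-- `z` is an output, at time `b`, of the continuous greedy algorithm for `f` over `Q`, run
with `N` steps of length `b / N`. It starts at `0`; in each step it has estimates `w e` of the
partial derivatives of `F` at the current point, the error being at most `δ * f {e}`, finds a
point `v` of `Q` that maximizes the linear function with coefficients `w`, and moves by
`(b / N) • v`. (`δ = 0` means that the gradient is evaluated exactly.) -/
def IsContinuousGreedyOutput {α : Type*} [Fintype α] [DecidableEq α] (f : Finset α → ℝ)
    (Q : Set (α → ℝ)) (b : ℝ) (N : ℕ) (δ : ℝ) (z : α → ℝ) : Prop :=
  ∃ x w v : ℕ → α → ℝ,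
    x 0 = 0 ∧ x N = z ∧
    ∀ t < N,
      (∀ e, |w t e - multilinearGrad f (x t) e| ≤ δ * f {e}) ∧
      v t ∈ Q ∧
      (∀ y ∈ Q, ∑ e, w t e * y e ≤ ∑ e, w t e * v t e) ∧
      x (t + 1) = x t + (b / N) • v t

/-! ### Constraint families and relaxations -/

/-- `P` is a polyhedral relaxation of the constraint family `feas`: a polyhedron contained in
`[0,1]^n` that contains the indicator vectors of all feasible sets. -/
structure IsPolyhedralRelaxation {n : ℕ} (feas : Finset (Finset (Fin n)))
    (P : Set (Fin n → ℝ)) : Prop where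
  polyhedron : ∃ (m : ℕ) (A : Matrix (Fin m) (Fin n) ℝ) (β : Fin m → ℝ),
    P = {x | ∀ j, A.mulVec x j ≤ β j}
  subset_cube : ∀ x ∈ P, ∀ i, x i ∈ Set.Icc (0 : ℝ) 1
  indicator_mem : ∀ S ∈ feas, (fun i => if i ∈ S then (1 : ℝ) else 0) ∈ P

/-- `P` is downward closed among the non-negative vectors. -/
def IsDownwardClosed {n : ℕ} (P : Set (Fin n → ℝ)) : Prop :=
  ∀ x ∈ P, ∀ y : Fin n → ℝ, 0 ≤ y → y ≤ x → y ∈ P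

/-! ### Greedy online contention resolution schemes -/

/-- A (randomized) greedy OCRS for the relaxation `P` of `feas`: for every `x ∈ P`, a probability
distribution `law x` on the (non-empty) down-closed subfamilies of `feas`. The scheme draws a
family from `law x` and selects an arriving active element exactly if, together with the
elements selected so far, it forms a set in the family. -/
structure GreedyOCRS {n : ℕ} (feas : Finset (Finset (Fin n))) (P : Set (Fin n → ℝ)) where
  law : (Fin n → ℝ) → Finset (Finset (Fin n)) → ℝ
  law_mem : ∀ x ∈ P, law x ∈ stdSimplex ℝ (Finset (Finset (Fin n)))
  law_support : ∀ x ∈ P, ∀ 𝓕, law x 𝓕 ≠ 0 →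
    𝓕 ⊆ feas ∧ ∅ ∈ 𝓕 ∧ IsLowerSet (𝓕 : Set (Finset (Fin n)))

/-- `(b,c)`-selectability: for all `x ∈ b • P` and all elements `e`, with probability at least
`c` over the family `𝓕` and the independent random set `R ∼ x`, every `J ⊆ R` with `J ∈ 𝓕`
satisfies `J ∪ {e} ∈ 𝓕`. -/
def GreedyOCRS.IsSelectable {n : ℕ} {feas : Finset (Finset (Fin n))} {P : Set (Fin n → ℝ)}
    (π : GreedyOCRS feas P) (b c : ℝ) : Prop :=
  ∀ x ∈ b • P, ∀ e : Fin n,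
    c ≤ ∑ 𝓕 : Finset (Finset (Fin n)), ∑ R : Finset (Fin n),
      if ∀ J ∈ R.powerset, J ∈ 𝓕 → insert e J ∈ 𝓕 then π.law x 𝓕 * prodProb x R else 0

/-! ### The submodular prophet inequality problem -/

/-- The data of the Submodular Prophet Inequality problem with days `Fin n`: the finite range
`U i` and the distribution `D i` of the variable `X i` (the variables are independent), a
downward-closed family `feas` of feasible sets of days, and an objective function `f` on the sets
of elements of the disjoint union of the ranges. -/
structure Instance (n : ℕ) where
  U : Fin n → Type u
  [fintypeU : ∀ i, Fintype (U i)]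
  [decEqU : ∀ i, DecidableEq (U i)]
  D : ∀ i, U i → ℝ
  D_mem : ∀ i, D i ∈ stdSimplex ℝ (U i)
  feas : Finset (Finset (Fin n))
  empty_mem_feas : ∅ ∈ feas
  isLowerSet_feas : IsLowerSet (feas : Set (Finset (Fin n)))
  f : Finset (Σ i, U i) → ℝ

attribute [instance] Instance.fintypeU Instance.decEqU

namespace Instance

variable {n : ℕ} (I : Instance.{u} n)

/-- The universe of elements, the disjoint union of the ranges. -/
abbrev Elem : Type u := Σ i, I.U i

/-- The prophet's value: the expectation of `max_{T ∈ feas} f {X_i | i ∈ T}`. -/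
def OPT : ℝ :=
  ∑ X : (∀ i, I.U i), (∏ i, I.D i (X i)) *
    I.feas.sup' ⟨∅, I.empty_mem_feas⟩
      (fun T => I.f (T.image (fun i => (⟨i, X i⟩ : I.Elem))))

/-- The relaxation of the constraint on the elements: vectors in the unit cube whose
sums over the ranges `U i` form a point of `P`, and which are bounded by the probabilities of
the elements. -/
def relaxation (P : Set (Fin n → ℝ)) : Set (I.Elem → ℝ) :=
  {y | (∀ a, y a ∈ Set.Icc (0 : ℝ) 1) ∧ (fun i => ∑ e : I.U i, y ⟨i, e⟩) ∈ P ∧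
    ∀ a : I.Elem, y a ≤ I.D a.1 a.2}

/-! ### The rounding algorithm -/

/-- The restriction of `z` to the elements of day `i`. -/
def dayPart (z : I.Elem → ℝ) (i : Fin n) : I.U i → ℝ := fun e => z ⟨i, e⟩

/-- The vector given to the OCRS: `x i` is the probability that `R ∼ z_i` is non-empty. -/
def ocrsInput (z : I.Elem → ℝ) : Fin n → ℝ := fun i => 1 - ∏ e, (1 - I.dayPart z i e)

/-- The conditional distribution of the random set `T i` given that `X i = e`: with
probability `Pr [R = {e}] / D i e` the set is `{e}`, and otherwise it is drawn as `R ∼ z_i`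
conditioned on `|R| ≠ 1`. -/
def setLaw (z : I.Elem → ℝ) (i : Fin n) (e : I.U i) (S : Finset (I.U i)) : ℝ :=
  let p : ℝ := prodProb (I.dayPart z i) {e} / I.D i e
  (if S = {e} then p else 0) +
    (1 - p) *
      (if S.card ≠ 1 then
        prodProb (I.dayPart z i) S /
          ∑ R ∈ Finset.univ.filter (fun R : Finset (I.U i) => R.card ≠ 1),
            prodProb (I.dayPart z i) R
      else 0)

/-- An outcome of all the random choices: the realizations `X i`, the random sets `T i` drawn by
the algorithm, and the family `𝓕` drawn by the greedy OCRS. -/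
structure Outcome where
  X : ∀ i, I.U i
  T : ∀ i, Finset (I.U i)
  family : Finset (Finset (Fin n))

/-- Outcomes as triples. -/
def outcomeEquiv :
    I.Outcome ≃ (∀ i, I.U i) × (∀ i, Finset (I.U i)) × Finset (Finset (Fin n)) where
  toFun ω := (ω.X, ω.T, ω.family)
  invFun t := ⟨t.1, t.2.1, t.2.2⟩
  left_inv _ := rfl
  right_inv _ := rfl

instance : Fintype I.Outcome := Fintype.ofEquiv _ I.outcomeEquiv.symm

/-- The probability of an outcome: the days are independent of each other and of the coins of
the OCRS. -/
def outcomeProb {P : Set (Fin n → ℝ)} (π : GreedyOCRS I.feas P) (z : I.Elem → ℝ)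
    (ω : I.Outcome) : ℝ :=
  (∏ i, I.D i (ω.X i) * I.setLaw z i (ω.X i) (ω.T i)) * π.law (I.ocrsInput z) ω.family

/-- One day of the algorithm, on which the variable `X i` arrives. The state consists of the set
of days selected so far by the OCRS and the current solution. If `T i ≠ ∅`, day `i` is fed to
the OCRS, and if it is selected and `T i = {X i}`, then `X i` is added to the solution. -/
def step (ω : I.Outcome) (s : Finset (Fin n) × Finset I.Elem) (i : Fin n) :
    Finset (Fin n) × Finset I.Elem :=
  if ω.T i ≠ ∅ ∧ insert i s.1 ∈ ω.family then
    (insert i s.1, if ω.T i = {ω.X i} then insert ⟨i, ω.X i⟩ s.2 else s.2)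
  else s

/-- The set returned by the algorithm if `X (σ h)` is the variable that arrives on the `h`-th
day. -/
def output (ω : I.Outcome) (σ : Equiv.Perm (Fin n)) : Finset I.Elem :=
  (((List.finRange n).map σ).foldl (I.step ω) (∅, ∅)).2

/-- An almighty adversary chooses the order of arrival with full knowledge of the realizations
and of all the coins of the algorithm. Given these, the behaviour of the algorithm is a function
of the order, so that an adaptive choice of the order is the same as a function from outcomes to
permutations. -/
abbrev Adversary : Type u := I.Outcome → Equiv.Perm (Fin n)

/-! ### The reduction to small probabilities -/

/-- The instance in which each element `e` of `U i` is replaced by `k i e` equally likely copies;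
the objective treats the copies of an element as this element. -/
def split (k : ∀ i, I.U i → ℕ+) : Instance.{u} n where
  U i := Σ e : I.U i, Fin (k i e)
  D i a := I.D i a.1 / (k i a.1 : ℕ)
  D_mem i := by
    refine ⟨fun a => div_nonneg ((I.D_mem i).1 _) (Nat.cast_nonneg _), ?_⟩
    rw [Fintype.sum_sigma, ← (I.D_mem i).2]
    refine Finset.sum_congr rfl fun e _ => ?_
    have h : ((k i e : ℕ) : ℝ) ≠ 0 := Nat.cast_ne_zero.mpr (k i e).ne_zero
    simp only [Finset.sum_const, Finset.card_univ, Fintype.card_fin, nsmul_eq_mul]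
    field_simp
  feas := I.feas
  empty_mem_feas := I.empty_mem_feas
  isLowerSet_feas := I.isLowerSet_feas
  f A := I.f (A.image fun a => ⟨a.1, a.2.1⟩)

/-- The set of the elements whose copies are in `A`. -/
def merge (k : ∀ i, I.U i → ℕ+) (A : Finset (I.split k).Elem) : Finset I.Elem :=
  A.image fun a => ⟨a.1, a.2.1⟩

end Instance

end

end SubmodularProphet

/-! Let `F` be the multilinear extension of `f`. The bound is the product of a guarantee for `F z`
and the fraction of `F z` that survives rounding.

Continuous greedy: let `y` be the vector of probabilities that the prophet takes each element. It
lies in the relaxation, as an average of indicators of feasible sets. Submodularity gives `f O ≤ f R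
+ ∑ e ∈ O, marginal f e R`. Averaging over `R ∼ x` and over the prophet's choice yields `OPT ≤ F x +
y · ∇F x`. A greedy step of length `r` thus closes a fraction `r` of the gap `OPT - F x`, up to a
small error, so `F z` is at least about `(1 - exp (-b)) * OPT`
(`IsContinuousGreedyOutput.le_multilinear`, `exists_mem_relaxation_OPT_le`).

Rounding: averaged over `X i`, the set `T i` has the law of `R ∼ z_i`. So the union of the `T i` is
`R ∼ z`, independent of the family of the OCRS (`sum_outcomeProb_mul`). Call an element of `R` kept
if it is alone on its day and no set of active days blocks this day. A kept element is selected in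
every order of arrival, which disarms the almighty adversary (`subset_output`). Being kept is a
decreasing event. By Harris' inequality its probability is at least `c` times the probability that
the day is empty, and the latter is nearly `exp (-b)` when all probabilities are small. Since the
event is decreasing and does not depend on the presence of the element itself, Harris again shows
that the kept set retains this fraction of `F z` (`le_multilinear_filter`).

Splitting makes the probabilities small without changing `OPT`, and preserves monotonicity and
submodularity. -/

namespace SubmodularProphet

/-! ### Marginal values of monotone submodular functions -/

section Submodular

variable {α : Type*} [DecidableEq α] {f : Finset α → ℝ}

lemma insert_erase_eq_insert (e : α) (R : Finset α) : insert e (R.erase e) = insert e R := by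
  ext a
  by_cases h : a = e <;> simp [h]

/-- The marginal value of `e` for a set from which `e` has been removed. -/
def marginal (f : Finset α → ℝ) (e : α) (R : Finset α) : ℝ := f (insert e R) - f (R.erase e)

lemma IsSubmodular.marginal_antitone (hs : IsSubmodular f) (hm : Monotone f) {S T : Finset α}
    (h : S ⊆ T) (e : α) : f (insert e T) - f T ≤ f (insert e S) - f S := by
  by_cases he : e ∈ T
  · rw [Finset.insert_eq_of_mem he]
    have := hm (Finset.subset_insert e S)
    linarith
  · have := hs (insert e S) T
    rw [Finset.insert_union, Finset.union_eq_right.2 h, Finset.insert_inter_of_notMem he,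
      Finset.inter_eq_left.2 h] at this
    linarith

lemma marginal_antitone (hs : IsSubmodular f) (hm : Monotone f) (e : α) :
    Antitone (marginal f e) := by
  intro S T h
  have := hs.marginal_antitone hm (Finset.erase_subset_erase e h) e
  simpa only [marginal, insert_erase_eq_insert] using this

lemma marginal_nonneg (hm : Monotone f) (e : α) (R : Finset α) : 0 ≤ marginal f e R :=
  sub_nonneg.2 (hm ((Finset.erase_subset e R).trans (Finset.subset_insert e R)))

lemma marginal_le (hs : IsSubmodular f) (hm : Monotone f) (h0 : 0 ≤ f ∅) (e : α) (R : Finset α) :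
    marginal f e R ≤ f {e} := by
  have := marginal_antitone hs hm e (Finset.empty_subset R)
  simp only [marginal, Finset.erase_empty, insert_empty_eq] at this ⊢
  linarith

/-- When the elements of `O` are added to `R` one at a time, diminishing returns bound each gain by
the marginal value at `R`. -/
lemma IsSubmodular.le_add_sum_marginal (hs : IsSubmodular f) (hm : Monotone f) (R O : Finset α) :
    f O ≤ f R + ∑ e ∈ O, marginal f e R := by
  have h : f (O ∪ R) ≤ f R + ∑ e ∈ O, marginal f e R := by
    induction O using Finset.induction_on with
    | empty => simp
    | insert e O he ih =>
      rw [Finset.sum_insert he, Finset.insert_union]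
      have h1 := hs.marginal_antitone hm (Finset.subset_union_right (s₁ := O) (s₂ := R)) e
      have h2 : f (insert e R) - f R ≤ marginal f e R :=
        sub_le_sub_left (hm (Finset.erase_subset e R)) _
      linarith
  exact (hm Finset.subset_union_left).trans h

end Submodular

/-! ### The multilinear extension, Harris' inequality and monotone contention resolution -/

section Multilinear

variable {α : Type*} [Fintype α] [DecidableEq α]

lemma prodProb_eq_prod_ite (x : α → ℝ) (S : Finset α) :
    prodProb x S = ∏ e, if e ∈ S then x e else 1 - x e := by
  rw [Finset.prod_ite]
  simp only [prodProb, Finset.filter_mem_eq_inter, Finset.univ_inter]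
  congr 2
  ext e
  simp

lemma prodProb_nonneg {x : α → ℝ} (hx : ∀ e, x e ∈ Set.Icc (0 : ℝ) 1) (S : Finset α) :
    0 ≤ prodProb x S :=
  mul_nonneg (Finset.prod_nonneg fun e _ => (hx e).1)
    (Finset.prod_nonneg fun e _ => sub_nonneg.2 (hx e).2)

lemma sum_prodProb (x : α → ℝ) : ∑ S, prodProb x S = 1 := by
  have h := Fintype.prod_add x (fun e => 1 - x e)
  simpa [prodProb] using h.symm

lemma multilinear_const (x : α → ℝ) (C : ℝ) : multilinear (fun _ => C) x = C := by
  simp [multilinear, ← Finset.sum_mul, sum_prodProb]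

lemma multilinear_add (f g : Finset α → ℝ) (x : α → ℝ) :
    multilinear (fun R => f R + g R) x = multilinear f x + multilinear g x := by
  simp [multilinear, mul_add, Finset.sum_add_distrib]

lemma multilinear_sub (f g : Finset α → ℝ) (x : α → ℝ) :
    multilinear (fun R => f R - g R) x = multilinear f x - multilinear g x := by
  simp [multilinear, mul_sub, Finset.sum_sub_distrib]

lemma multilinear_sum {ι : Type*} (s : Finset ι) (f : ι → Finset α → ℝ) (x : α → ℝ) :
    multilinear (fun R => ∑ j ∈ s, f j R) x = ∑ j ∈ s, multilinear (f j) x := by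
  simp only [multilinear, Finset.mul_sum]
  rw [Finset.sum_comm]

lemma multilinear_mono {f g : Finset α → ℝ} {x : α → ℝ} (hx : ∀ e, x e ∈ Set.Icc (0 : ℝ) 1)
    (h : ∀ R, f R ≤ g R) : multilinear f x ≤ multilinear g x :=
  Finset.sum_le_sum fun R _ => mul_le_mul_of_nonneg_left (h R) (prodProb_nonneg hx R)

lemma multilinear_zero (f : Finset α → ℝ) : multilinear f 0 = f ∅ := by
  rw [multilinear, Finset.sum_eq_single ∅]
  · simp [prodProb]
  · intro S _ hS
    obtain ⟨e, he⟩ := Finset.nonempty_iff_ne_empty.2 hS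
    simp [prodProb, Finset.prod_eq_zero he]
  · simp

lemma sum_finset_eq_sum_powerset_erase (e : α) (g : Finset α → ℝ) :
    ∑ S, g S = ∑ S ∈ (Finset.univ.erase e).powerset, (g S + g (insert e S)) := by
  rw [← Finset.powerset_univ, ← Finset.insert_erase (Finset.mem_univ e),
    Finset.sum_powerset_insert (Finset.notMem_erase _ _), Finset.sum_add_distrib]
  simp

/-- The law of `R ∼ x` outside `e` does not depend on `x e`. -/
lemma multilinear_update (f : Finset α → ℝ) (x : α → ℝ) (e : α) (y : ℝ) :
    multilinear f (Function.update x e y) =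
      y * multilinear (fun R => f (insert e R)) x +
        (1 - y) * multilinear (fun R => f (R.erase e)) x := by
  have key : ∀ (z : α → ℝ) (S : Finset α), e ∉ S →
      prodProb z S = (1 - z e) * ∏ a ∈ Finset.univ.erase e, (if a ∈ S then z a else 1 - z a) ∧
      prodProb z (insert e S) =
        z e * ∏ a ∈ Finset.univ.erase e, (if a ∈ S then z a else 1 - z a) := by
    intro z S hS
    constructor
    · rw [prodProb_eq_prod_ite, ← Finset.mul_prod_erase _ _ (Finset.mem_univ e), if_neg hS]
    · rw [prodProb_eq_prod_ite, ← Finset.mul_prod_erase _ _ (Finset.mem_univ e),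
        if_pos (Finset.mem_insert_self _ _)]
      congr 1
      refine Finset.prod_congr rfl fun a ha => ?_
      simp [Finset.mem_insert, Finset.ne_of_mem_erase ha]
  simp only [multilinear]
  rw [sum_finset_eq_sum_powerset_erase e, sum_finset_eq_sum_powerset_erase e,
    sum_finset_eq_sum_powerset_erase e, Finset.mul_sum, Finset.mul_sum, ← Finset.sum_add_distrib]
  refine Finset.sum_congr rfl fun S hS => ?_
  have hS' : e ∉ S := fun h => by simpa using Finset.mem_powerset.1 hS h
  obtain ⟨h1, h2⟩ := key (Function.update x e y) S hS'
  obtain ⟨h3, h4⟩ := key x S hS'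
  have hc : ∏ a ∈ Finset.univ.erase e,
      (if a ∈ S then Function.update x e y a else 1 - Function.update x e y a) =
      ∏ a ∈ Finset.univ.erase e, (if a ∈ S then x a else 1 - x a) := by
    refine Finset.prod_congr rfl fun a ha => ?_
    rw [Function.update_of_ne (Finset.ne_of_mem_erase ha)]
  rw [h1, h2, h3, h4, hc]
  simp only [Function.update_self, Finset.insert_idem, Finset.erase_insert hS',
    Finset.erase_eq_of_notMem hS']
  ring

lemma multilinear_split (f : Finset α → ℝ) (x : α → ℝ) (e : α) :
    multilinear f x = x e * multilinear (fun R => f (insert e R)) x +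
        (1 - x e) * multilinear (fun R => f (R.erase e)) x := by
  conv_lhs => rw [← Function.update_eq_self e x, multilinear_update]

/-- Pointwise inequalities between marginal values thereby become inequalities for the gradient. -/
lemma multilinearGrad_eq (f : Finset α → ℝ) (x : α → ℝ) (e : α) :
    multilinearGrad f x e = multilinear (marginal f e) x := by
  rw [multilinearGrad, multilinear_update, multilinear_update]
  rw [show multilinear (marginal f e) x = _ from multilinear_sub _ _ x]
  ring

lemma multilinear_update_sub (f : Finset α → ℝ) (x : α → ℝ) (e : α) (y : ℝ) :
    multilinear f (Function.update x e y) - multilinear f x =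
      (y - x e) * multilinear (marginal f e) x := by
  rw [multilinear_update, multilinear_split f x e]
  rw [show multilinear (marginal f e) x = _ from multilinear_sub _ _ x]
  ring

/-- The hypothesis says that `g` ignores `e`, so `g R` is independent of the event `e ∈ R`. -/
lemma multilinear_ite_mem {g : Finset α → ℝ} {e : α} (x : α → ℝ)
    (hg : ∀ R, g (insert e R) = g (R.erase e)) :
    multilinear (fun R => if e ∈ R then g R else 0) x = x e * multilinear g x := by
  have hg' : (fun R => g (insert e R)) = g := by
    funext R
    by_cases h : e ∈ R
    · rw [Finset.insert_eq_of_mem h]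
    · rw [hg, Finset.erase_eq_of_notMem h]
  rw [multilinear_split _ x e]
  simp [hg', multilinear_const]

/-- Harris' inequality for two decreasing functions. -/
lemma multilinear_mul_ge {f g : Finset α → ℝ} {x : α → ℝ} (hx : ∀ e, x e ∈ Set.Icc (0 : ℝ) 1)
    (hf0 : ∀ R, 0 ≤ f R) (hg0 : ∀ R, 0 ≤ g R) (hf : Antitone f) (hg : Antitone g) :
    multilinear f x * multilinear g x ≤ multilinear (fun R => f R * g R) x := by
  -- Decreasing functions are increasing on the order dual. A product measure satisfies the lattice
  -- condition with equality.
  have h := fkg (α := (Finset α)ᵒᵈ) (β := ℝ) (μ := fun S => prodProb x (OrderDual.ofDual S))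
    (f := fun S => f (OrderDual.ofDual S)) (g := fun S => g (OrderDual.ofDual S))
    (fun S => prodProb_nonneg hx _) (fun S => hf0 _) (fun S => hg0 _)
    (fun S T h => hf h) (fun S T h => hg h) ?_
  · have h1 : ∑ S : (Finset α)ᵒᵈ, prodProb x (OrderDual.ofDual S) = 1 := sum_prodProb x
    rw [h1, one_mul] at h
    exact h
  · intro S T
    have h : ∀ A B : Finset α,
        prodProb x A * prodProb x B = prodProb x (A ∪ B) * prodProb x (A ∩ B) := by
      intro A B
      simp only [prodProb_eq_prod_ite, ← Finset.prod_mul_distrib]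
      refine Finset.prod_congr rfl fun e _ => ?_
      by_cases h1 : e ∈ A <;> by_cases h2 : e ∈ B <;> simp [h1, h2, mul_comm]
    exact (h (OrderDual.ofDual S) (OrderDual.ofDual T)).le

/-- A monotone contention resolution argument: if the element `e` of `R ∼ x` is kept under a
condition `φ j e R` that is decreasing in `R`, does not depend on whether `e ∈ R`, and holds with
probability at least `γ`, the index `j` being random with weights `w`, then the set of kept
elements retains a `γ` fraction of the value. -/
lemma le_multilinear_filter {ι : Type*} [Fintype ι] {f : Finset α → ℝ} {x : α → ℝ}
    (hx : ∀ e, x e ∈ Set.Icc (0 : ℝ) 1) (h0 : 0 ≤ f ∅) (hm : Monotone f) (hs : IsSubmodular f)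
    {w : ι → ℝ} (hw : w ∈ stdSimplex ℝ ι) (φ : ι → α → Finset α → Prop)
    [∀ j e R, Decidable (φ j e R)] (hφ : ∀ j e S T, S ⊆ T → φ j e T → φ j e S)
    (hφ' : ∀ j e R, φ j e R → φ j e (insert e R)) {γ : ℝ} (hγ1 : γ ≤ 1)
    (hγ : ∀ e, γ ≤ ∑ j, w j * multilinear (fun R => if φ j e R then (1 : ℝ) else 0) x) :
    γ * multilinear f x ≤
      ∑ j, w j * multilinear (fun R => f (R.filter fun e => φ j e R)) x := by
  have key : ∀ U : Finset α, γ * (multilinear (fun R => f (R ∩ U)) x - f ∅) ≤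
      ∑ j, w j * (multilinear (fun R => f ((R.filter fun e => φ j e R) ∩ U)) x - f ∅) := by
    intro U
    induction U using Finset.induction_on with
    | empty => simp [multilinear_const]
    | insert e U he ih =>
      -- The elements are revealed one by one. The marginal of `e` over the revealed part of `R` is
      -- decreasing in `R`, and ignores `e` because `e ∉ U`.
      set h : Finset α → ℝ := fun R => f (insert e (R ∩ U)) - f (R ∩ U) with hdef
      have hU : ∀ R : Finset α, insert e R ∩ U = R.erase e ∩ U := by
        intro R; ext a; simp only [Finset.mem_inter, Finset.mem_insert, Finset.mem_erase]
        constructor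
        · rintro ⟨h1 | h1, h2⟩
          · exact absurd (h1 ▸ h2) he
          · exact ⟨⟨fun h3 => he (h3 ▸ h2), h1⟩, h2⟩
        · rintro ⟨h1, h2⟩; exact ⟨.inr h1.2, h2⟩
      have hh : ∀ R, h (insert e R) = h (R.erase e) := by
        intro R; simp only [hdef, hU]
      have hh0 : ∀ R, 0 ≤ h R := fun R => sub_nonneg.2 (hm (Finset.subset_insert _ _))
      have hha : Antitone h := fun S T hST =>
        hs.marginal_antitone hm (Finset.inter_subset_inter_right hST) e
      have e1 : multilinear (fun R => f (R ∩ insert e U)) x =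
          multilinear (fun R => f (R ∩ U)) x + x e * multilinear h x := by
        rw [← multilinear_ite_mem x hh, ← multilinear_add]
        congr 1; funext R
        by_cases heR : e ∈ R
        · simp [heR, Finset.inter_insert_of_mem heR, hdef]
        · simp [heR, Finset.inter_insert_of_notMem heR]
      -- A kept `e` adds at least `h R`, because the filtered set is smaller than `R`. The events
      -- "kept" and `h` are both decreasing, so Harris bounds the expectation of their product from
      -- below.
      have e2 : ∀ j, multilinear (fun R => f ((R.filter fun e => φ j e R) ∩ U)) x +
          x e * (multilinear (fun R => if φ j e R then (1 : ℝ) else 0) x * multilinear h x) ≤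
          multilinear (fun R => f ((R.filter fun e => φ j e R) ∩ insert e U)) x := by
        intro j
        have hH := multilinear_mul_ge (f := fun R => if φ j e R then (1 : ℝ) else 0) (g := h) hx
          (fun R => by positivity) hh0 (fun S T hST => by
            by_cases hT : φ j e T
            · simp [hT, hφ j e S T hST hT]
            · simp only [hT, if_false]; positivity) hha
        have hI := multilinear_ite_mem (e := e)
          (g := fun R => (if φ j e R then (1 : ℝ) else 0) * h R) x (fun R => by
            have : φ j e (insert e R) ↔ φ j e (R.erase e) :=
              ⟨hφ j e _ _ ((Finset.erase_subset e R).trans (Finset.subset_insert e R)),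
                fun h' => by simpa only [insert_erase_eq_insert] using hφ' j e _ h'⟩
            simp only [this, hh])
        refine le_trans (add_le_add_right (mul_le_mul_of_nonneg_left hH (hx e).1) _) ?_
        rw [← hI, ← multilinear_add]
        refine multilinear_mono hx fun R => ?_
        by_cases heR : e ∈ R
        · by_cases hp : φ j e R
          · have hmem : e ∈ R.filter fun e => φ j e R := by simp [heR, hp]
            rw [Finset.inter_insert_of_mem hmem]
            have := hs.marginal_antitone hm (Finset.inter_subset_inter_right (u := U)
              (Finset.filter_subset (fun e => φ j e R) R)) e
            simp only [heR, hp, if_true, one_mul, hdef]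
            linarith
          · simp only [heR, hp, if_true, if_false, zero_mul, add_zero]
            exact hm (Finset.inter_subset_inter_left (Finset.subset_insert e U))
        · simp only [heR, if_false, add_zero]
          exact hm (Finset.inter_subset_inter_left (Finset.subset_insert e U))
      have hMh : 0 ≤ multilinear h x := by
        simpa [multilinear_const] using multilinear_mono hx (f := fun _ => 0) hh0
      have e3 : ∑ j, w j * (multilinear (fun R => f ((R.filter fun e => φ j e R) ∩ U)) x - f ∅) +
          x e * multilinear h x *
            ∑ j, w j * multilinear (fun R => if φ j e R then (1 : ℝ) else 0) x ≤
          ∑ j, w j * (multilinear (fun R => f ((R.filter fun e => φ j e R) ∩ insert e U)) x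
            - f ∅) := by
        rw [Finset.mul_sum, ← Finset.sum_add_distrib]
        refine Finset.sum_le_sum fun j _ => ?_
        have := mul_le_mul_of_nonneg_left (e2 j) (hw.1 j)
        nlinarith
      refine le_trans ?_ e3
      have := mul_le_mul_of_nonneg_left (hγ e) (mul_nonneg (hx e).1 hMh)
      rw [e1]
      nlinarith
  -- This is the claim for `f - f ∅`; the constants cost nothing since `γ ≤ 1` and `0 ≤ f ∅`.
  have hU := key Finset.univ
  simp only [Finset.inter_univ, mul_sub, Finset.sum_sub_distrib, ← Finset.sum_mul, hw.2] at hU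
  nlinarith

end Multilinear

end SubmodularProphet

/-! ### Continuous greedy with estimated gradients and finitely many steps -/

namespace SubmodularProphet

lemma piecewise_mem_Icc {α : Type*} [DecidableEq α] {x y : α → ℝ} (hx : ∀ e, x e ∈ Set.Icc (0 : ℝ) 1)
    (hy : ∀ e, y e ∈ Set.Icc (0 : ℝ) 1) (U : Finset α) (e : α) :
    U.piecewise y x e ∈ Set.Icc (0 : ℝ) 1 := by
  by_cases h : e ∈ U <;> simp only [h, Finset.piecewise_eq_of_mem, Finset.piecewise_eq_of_notMem,
    not_false_eq_true]
  exacts [hy e, hx e]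

section ContinuousGreedy

variable {α : Type*} [Fintype α] [DecidableEq α]

lemma multilinear_piecewise_insert_sub (f : Finset α → ℝ) (x y : α → ℝ) {U : Finset α} {e : α}
    (he : e ∉ U) :
    multilinear f ((insert e U).piecewise y x) - multilinear f (U.piecewise y x) =
      (y e - x e) * multilinear (marginal f e) (U.piecewise y x) := by
  rw [Finset.piecewise_insert, multilinear_update_sub, Finset.piecewise_eq_of_notMem _ _ _ he]

/-- The expectation of a bounded function changes slowly along an increasing path. -/
lemma multilinear_sub_le_piecewise {g : Finset α → ℝ} {C : ℝ} (hg0 : ∀ R, 0 ≤ g R)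
    (hgC : ∀ R, g R ≤ C) {x y : α → ℝ} (hx : ∀ e, x e ∈ Set.Icc (0 : ℝ) 1)
    (hy : ∀ e, y e ∈ Set.Icc (0 : ℝ) 1) (hxy : x ≤ y) (U : Finset α) :
    multilinear g x - C * ∑ e, (y e - x e) ≤ multilinear g (U.piecewise y x) := by
  have key : multilinear g x - C * ∑ e ∈ U, (y e - x e) ≤ multilinear g (U.piecewise y x) := by
    induction U using Finset.induction_on with
    | empty => simp
    | insert e U he ih =>
      have h1 := multilinear_piecewise_insert_sub g x y he
      have h2 : -C ≤ multilinear (marginal g e) (U.piecewise y x) := by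
        rw [← multilinear_const (U.piecewise y x) (-C)]
        refine multilinear_mono (piecewise_mem_Icc hx hy U) fun R => ?_
        have := hg0 (insert e R)
        have := hgC (R.erase e)
        simp only [marginal]
        linarith
      have h3 := mul_le_mul_of_nonneg_left h2 (sub_nonneg.2 (hxy e))
      rw [Finset.sum_insert he]
      linarith
  have hC : 0 ≤ C := (hg0 ∅).trans (hgC ∅)
  have : ∑ e ∈ U, (y e - x e) ≤ ∑ e, (y e - x e) :=
    Finset.sum_le_sum_of_subset_of_nonneg (Finset.subset_univ U) fun e _ _ => sub_nonneg.2 (hxy e)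
  have := mul_le_mul_of_nonneg_left this hC
  linarith

/-- A first order lower bound for the growth of the multilinear extension of a monotone
submodular function along an increasing segment. -/
lemma sum_mul_grad_le_multilinear_sub {f : Finset α → ℝ} (h0 : 0 ≤ f ∅) (hm : Monotone f)
    (hs : IsSubmodular f) {x y : α → ℝ} (hx : ∀ e, x e ∈ Set.Icc (0 : ℝ) 1)
    (hy : ∀ e, y e ∈ Set.Icc (0 : ℝ) 1) (hxy : x ≤ y) :
    ∑ e, (y e - x e) * (multilinearGrad f x e - f {e} * ∑ a, (y a - x a)) ≤
      multilinear f y - multilinear f x := by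
  have key : ∀ U : Finset α,
      ∑ e ∈ U, (y e - x e) * (multilinearGrad f x e - f {e} * ∑ a, (y a - x a)) ≤
        multilinear f (U.piecewise y x) - multilinear f x := by
    intro U
    induction U using Finset.induction_on with
    | empty => simp
    | insert e U he ih =>
      -- The coordinates move from `x` to `y` one at a time. The derivative at the mixed point falls
      -- short of the one at `x` by at most `f {e}`, which bounds the marginals, times the total
      -- displacement.
      rw [Finset.sum_insert he, multilinearGrad_eq]
      have h1 := multilinear_piecewise_insert_sub f x y he
      have h2 := multilinear_sub_le_piecewise (g := marginal f e) (marginal_nonneg hm e)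
        (marginal_le hs hm h0 e) hx hy hxy U
      have h3 := mul_le_mul_of_nonneg_left h2 (sub_nonneg.2 (hxy e))
      linarith
  simpa using key Finset.univ

/-- The output is `b` times the average of the directions `v t`. -/
lemma IsContinuousGreedyOutput.mem_smul {f : Finset α → ℝ} {Q : Set (α → ℝ)} (hQ : Convex ℝ Q)
    {b δ : ℝ} {N : ℕ} (hN : 0 < N) {z : α → ℝ} (h : IsContinuousGreedyOutput f Q b N δ z) :
    z ∈ b • Q := by
  obtain ⟨x, w, v, hx0, rfl, hstep⟩ := h
  have hN' : (N : ℝ) ≠ 0 := Nat.cast_ne_zero.2 hN.ne'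
  have key : ∀ t ≤ N, x t = ∑ s ∈ Finset.range t, (b / N) • v s := by
    intro t
    induction t with
    | zero => simp [hx0]
    | succ t ih =>
      intro ht
      rw [Finset.sum_range_succ, ← ih (by omega), (hstep t (by omega)).2.2.2]
  refine ⟨∑ s ∈ Finset.range N, (1 / (N : ℝ)) • v s, ?_, ?_⟩
  · refine hQ.sum_mem (fun _ _ => by positivity) ?_ fun s hs =>
      (hstep s (Finset.mem_range.1 hs)).2.1
    simp [hN']
  · simp only [key N le_rfl, Finset.smul_sum, smul_smul]
    refine Finset.sum_congr rfl fun s _ => ?_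
    rw [mul_one_div]

/-- Discrete form of the differential inequality `F' ≥ V - F`. All errors are proportional to `b *
V`, which later allows them to be absorbed into `1 - exp (-b)`. -/
lemma IsContinuousGreedyOutput.le_multilinear {f : Finset α → ℝ} (h0 : ∀ A, 0 ≤ f A)
    (hm : Monotone f) (hs : IsSubmodular f) {Q : Set (α → ℝ)} {D : α → ℝ} {m V : ℝ}
    (hm0 : (Fintype.card α : ℝ) ≤ m) (hV : 0 ≤ V)
    (hQ : ∀ v ∈ Q, ∀ e, v e ∈ Set.Icc (0 : ℝ) 1 ∧ v e ≤ D e)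
    (hD : ∑ e, D e * f {e} ≤ m * V)
    (hopt : ∀ x : α → ℝ, (∀ e, x e ∈ Set.Icc (0 : ℝ) 1) →
      ∃ y ∈ Q, V ≤ multilinear f x + ∑ e, y e * multilinearGrad f x e)
    {b δ : ℝ} (hb : b ∈ Set.Icc (0 : ℝ) 1) (hδ : 0 ≤ δ) {N : ℕ} (hN : 0 < N) {z : α → ℝ}
    (h : IsContinuousGreedyOutput f Q b N δ z) :
    (1 - Real.exp (-b) - b * (2 * δ * m + m ^ 2 / N)) * V ≤ multilinear f z := by
  obtain ⟨x, w, v, hx0, rfl, hstep⟩ := h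
  have hN' : (0 : ℝ) < N := Nat.cast_pos.2 hN
  have hm1 : 0 ≤ m := (Nat.cast_nonneg _).trans hm0
  set r : ℝ := b / N with hr
  have hr0 : 0 ≤ r := div_nonneg hb.1 hN'.le
  have hrN : r ≤ 1 / N := by rw [hr]; gcongr; exact hb.2
  have hr1 : r ≤ 1 := hrN.trans (by
    rw [div_le_one hN']; exact_mod_cast hN)
  set η : ℝ := 2 * δ * m + m ^ 2 / N with hη
  have hxb : ∀ t ≤ N, ∀ e, 0 ≤ x t e ∧ x t e ≤ t * (1 / N) := by
    intro t
    induction t with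
    | zero => simp [hx0]
    | succ t ih =>
      intro ht e
      obtain ⟨-, hv, -, hx⟩ := hstep t (by omega)
      obtain ⟨h1, h2⟩ := ih (by omega) e
      obtain ⟨⟨h3, h4⟩, -⟩ := hQ _ hv e
      rw [hx]
      simp only [Pi.add_apply, Pi.smul_apply, smul_eq_mul]
      have h5 : r * v t e ≤ 1 / N * 1 := mul_le_mul hrN h4 h3 (by positivity)
      push_cast
      exact ⟨by positivity, by linarith⟩
  have hxI : ∀ t ≤ N, ∀ e, x t e ∈ Set.Icc (0 : ℝ) 1 := by
    intro t ht e
    refine ⟨(hxb t ht e).1, (hxb t ht e).2.trans ?_⟩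
    rw [mul_one_div, div_le_one hN']
    exact_mod_cast ht
  have hgain : ∀ t < N, r * (V - multilinear f (x t)) - r * (η * V) ≤
      multilinear f (x (t + 1)) - multilinear f (x t) := by
    intro t ht
    obtain ⟨hw, hv, hmax, hx⟩ := hstep t ht
    obtain ⟨y, hy, hyV⟩ := hopt (x t) (hxI t ht.le)
    have hdiff : ∀ e, x (t + 1) e - x t e = r * v t e := by
      intro e; rw [hx]; simp
    have hmono : x t ≤ x (t + 1) := fun e => by
      have h1 := hdiff e
      have h2 := mul_nonneg hr0 (hQ _ hv e).1.1
      linarith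
    have h1 := sum_mul_grad_le_multilinear_sub (h0 ∅) hm hs (hxI t ht.le) (hxI (t + 1) ht) hmono
    simp only [hdiff, ← Finset.mul_sum] at h1
    have hDf : ∀ u ∈ Q, ∑ e, u e * f {e} ≤ m * V := fun u hu =>
      (Finset.sum_le_sum fun e _ => mul_le_mul_of_nonneg_right (hQ u hu e).2 (h0 _)).trans hD
    have h2 : ∑ e, v t e ≤ m := by
      refine (Finset.sum_le_sum fun e _ => (hQ _ hv e).1.2).trans ?_
      simpa using hm0
    have h2' : 0 ≤ ∑ e, v t e := Finset.sum_nonneg fun e _ => (hQ _ hv e).1.1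
    have h3 : r * ∑ e, v t e ≤ m / N := by
      rw [div_eq_inv_mul, ← one_div]; exact mul_le_mul hrN h2 h2' (by positivity)
    have h4 : ∀ u ∈ Q, |∑ e, w t e * u e - ∑ e, u e * multilinearGrad f (x t) e| ≤
        δ * (m * V) := by
      intro u hu
      rw [← Finset.sum_sub_distrib]
      refine (Finset.abs_sum_le_sum_abs _ _).trans (le_trans ?_
        (mul_le_mul_of_nonneg_left (hDf u hu) hδ))
      rw [Finset.mul_sum]
      refine Finset.sum_le_sum fun e _ => ?_
      rw [mul_comm (w t e), ← mul_sub, abs_mul, abs_of_nonneg (hQ u hu e).1.1]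
      have := mul_le_mul_of_nonneg_left (hw e) (hQ u hu e).1.1
      linarith
    have h5 := (abs_le.1 (h4 y hy)).1
    have h6 := (abs_le.1 (h4 _ hv)).2
    have h7 := hmax y hy
    have h8 : ∑ e, r * v t e * (multilinearGrad f (x t) e - f {e} * (r * ∑ a, v t a)) =
        r * (∑ e, v t e * multilinearGrad f (x t) e -
          (r * ∑ a, v t a) * ∑ e, v t e * f {e}) := by
      generalize ∑ a, v t a = s
      rw [Finset.mul_sum, ← Finset.sum_sub_distrib, Finset.mul_sum]
      exact Finset.sum_congr rfl fun e _ => by ring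
    have h9 : (r * ∑ a, v t a) * ∑ e, v t e * f {e} ≤ m / N * (m * V) :=
      mul_le_mul h3 (hDf _ hv) (Finset.sum_nonneg fun e _ => mul_nonneg (hQ _ hv e).1.1 (h0 _))
        (by positivity)
    have h10 : V - multilinear f (x t) - η * V ≤ ∑ e, v t e * multilinearGrad f (x t) e -
          (r * ∑ a, v t a) * ∑ e, v t e * f {e} := by
      have : η * V = 2 * (δ * (m * V)) + m / N * (m * V) := by rw [hη]; ring
      linarith
    have h11 := mul_le_mul_of_nonneg_left h10 hr0
    rw [h8] at h1
    linarith
  -- Each step multiplies the gap by `1 - r` and adds at most `r * (η * V)`.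
  have hrec : ∀ t ≤ N, V - multilinear f (x t) ≤ (1 - r) ^ t * V + t * (r * (η * V)) := by
    intro t
    induction t with
    | zero =>
      intro _
      rw [hx0, multilinear_zero]
      have := h0 ∅
      simp [this]
    | succ t ih =>
      intro ht
      have h1 := mul_le_mul_of_nonneg_left (ih (by omega)) (sub_nonneg.2 hr1)
      have h2 := hgain t (by omega)
      have h3 : 0 ≤ t * (r * (η * V)) := by positivity
      have h4 : (1 - r) * (t * (r * (η * V))) ≤ t * (r * (η * V)) :=
        mul_le_of_le_one_left h3 (by linarith)
      rw [pow_succ]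
      push_cast
      linarith
  have h1 := hrec N le_rfl
  have h2 : (N : ℝ) * r = b := by rw [hr]; field_simp
  have h3 : (1 - r) ^ N ≤ Real.exp (-b) := by
    refine (pow_le_pow_left₀ (sub_nonneg.2 hr1) (Real.one_sub_le_exp_neg r) N).trans ?_
    rw [← Real.exp_nat_mul, mul_neg, h2]
  have h4 := mul_le_mul_of_nonneg_right h3 hV
  have h5 : (N : ℝ) * (r * (η * V)) = b * η * V := by rw [← h2]; ring
  rw [h5] at h1
  linarith

end ContinuousGreedy

end SubmodularProphet

/-! ### The prophet's value, the relaxation and the split instance -/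

namespace SubmodularProphet

/-- The image of a product measure under a coordinatewise map is the product of the images. -/
lemma sum_prod_mul_comp {ι : Type*} [Fintype ι] [DecidableEq ι] {κ κ' : ι → Type*}
    [∀ i, Fintype (κ i)] [∀ i, Fintype (κ' i)] [∀ i, DecidableEq (κ' i)] (p : ∀ i, κ i → ℝ)
    (φ : ∀ i, κ i → κ' i) (G : (∀ i, κ' i) → ℝ) :
    ∑ X : ∀ i, κ i, (∏ i, p i (X i)) * G (fun i => φ i (X i)) =
      ∑ Y : ∀ i, κ' i, (∏ i, ∑ a, if φ i a = Y i then p i a else 0) * G Y := by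
  classical
  have h : ∀ Y : ∀ i, κ' i, (∏ i, ∑ a, if φ i a = Y i then p i a else 0) =
      ∑ X : ∀ i, κ i, if (fun i => φ i (X i)) = Y then ∏ i, p i (X i) else 0 := by
    intro Y
    rw [Finset.prod_univ_sum, Fintype.piFinset_univ]
    refine Finset.sum_congr rfl fun X _ => ?_
    rw [Finset.prod_ite_zero]
    simp [funext_iff]
  simp only [h, Finset.sum_mul]
  rw [Finset.sum_comm]
  refine Finset.sum_congr rfl fun X _ => ?_
  rw [Finset.sum_eq_single (fun i => φ i (X i))]
  · simp
  · intro Y _ hY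
    simp [hY.symm]
  · simp

lemma sum_prod_mul_apply {ι : Type*} [Fintype ι] [DecidableEq ι] {κ : ι → Type*}
    [∀ i, Fintype (κ i)] {p : ∀ i, κ i → ℝ} (hp : ∀ i, ∑ e, p i e = 1) (i : ι) (g : κ i → ℝ) :
    ∑ X : ∀ i, κ i, (∏ j, p j (X j)) * g (X i) = ∑ e, p i e * g e := by
  set g' : ∀ j, κ j → ℝ := Function.update (fun _ _ => 1) i g with hg
  have h1 : ∀ X : ∀ i, κ i, (∏ j, p j (X j)) * g (X i) = ∏ j, p j (X j) * g' j (X j) := by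
    intro X
    rw [Finset.prod_mul_distrib]
    congr 1
    rw [Finset.prod_eq_single i]
    · simp [hg]
    · intro j _ hj
      simp [hg, Function.update_of_ne hj]
    · simp
  simp only [h1]
  rw [← Fintype.piFinset_univ, ← Finset.prod_univ_sum (fun _ => Finset.univ)
    (fun j e => p j e * g' j e), Finset.prod_eq_single i]
  · simp [hg]
  · intro j _ hj
    simp [hg, Function.update_of_ne hj, hp]
  · simp

lemma IsPolyhedralRelaxation.convex {n : ℕ} {feas : Finset (Finset (Fin n))}
    {P : Set (Fin n → ℝ)} (h : IsPolyhedralRelaxation feas P) : Convex ℝ P := by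
  obtain ⟨m, A, β, rfl⟩ := h.polyhedron
  intro x hx y hy s t hs ht hst j
  rw [Matrix.mulVec_add, Matrix.mulVec_smul, Matrix.mulVec_smul]
  simp only [Pi.add_apply, Pi.smul_apply, smul_eq_mul]
  have h1 := mul_le_mul_of_nonneg_left (hx j) hs
  have h2 := mul_le_mul_of_nonneg_left (hy j) ht
  have : β j = s * β j + t * β j := by rw [← add_mul, hst, one_mul]
  linarith

lemma IsPolyhedralRelaxation.zero_mem {n : ℕ} {feas : Finset (Finset (Fin n))}
    {P : Set (Fin n → ℝ)} (h : IsPolyhedralRelaxation feas P) (h0 : ∅ ∈ feas) : 0 ∈ P := by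
  simpa using! h.indicator_mem ∅ h0

/-- At `x = 0`, some family of positive weight must allow `i` to be added to `J = ∅`. -/
lemma GreedyOCRS.IsSelectable.singleton_mem {n : ℕ} {feas : Finset (Finset (Fin n))}
    {P : Set (Fin n → ℝ)} {π : GreedyOCRS feas P} {b c : ℝ} (h : π.IsSelectable b c)
    (h0 : (0 : Fin n → ℝ) ∈ P) (hc : 0 < c) (i : Fin n) : {i} ∈ feas := by
  have h1 := hc.trans_le (h 0 ⟨0, h0, by simp⟩ i)
  obtain ⟨𝓕, -, h𝓕⟩ := Finset.exists_ne_zero_of_sum_ne_zero h1.ne'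
  obtain ⟨R, -, hR⟩ := Finset.exists_ne_zero_of_sum_ne_zero h𝓕
  split_ifs at hR with hJ
  · obtain ⟨h2, h3, -⟩ := π.law_support 0 h0 𝓕 (left_ne_zero_of_mul hR)
    exact h2 (by simpa using hJ ∅ (Finset.empty_mem_powerset R) h3)
  · exact absurd rfl hR

namespace Instance

variable {n : ℕ} (I : Instance.{u} n)

lemma convex_relaxation {P : Set (Fin n → ℝ)} (hP : Convex ℝ P) : Convex ℝ (I.relaxation P) := by
  rintro x ⟨hx1, hx2, hx3⟩ y ⟨hy1, hy2, hy3⟩ s t hs ht hst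
  refine ⟨fun a => (convex_Icc (0 : ℝ) 1) (hx1 a) (hy1 a) hs ht hst, ?_, fun a => ?_⟩
  · have := hP hx2 hy2 hs ht hst
    convert this using 1
    funext i
    simp [Finset.sum_add_distrib, Finset.mul_sum]
  · exact (convex_Iic (I.D a.1 a.2)) (hx3 a) (hy3 a) hs ht hst

/-- The probability that the realizations are `X`. -/
noncomputable def realizationProb (X : ∀ i, I.U i) : ℝ := ∏ i, I.D i (X i)

lemma realizationProb_nonneg (X : ∀ i, I.U i) : 0 ≤ I.realizationProb X :=
  Finset.prod_nonneg fun i _ => (I.D_mem i).1 _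

lemma sum_realizationProb_mul (i : Fin n) (g : I.U i → ℝ) :
    ∑ X, I.realizationProb X * g (X i) = ∑ e, I.D i e * g e :=
  sum_prod_mul_apply (fun i => (I.D_mem i).2) i g

lemma sum_realizationProb : ∑ X, I.realizationProb X = 1 := by
  have h : ∏ i, ∑ e, I.D i e = 1 := Finset.prod_eq_one fun i _ => (I.D_mem i).2
  rw [Finset.prod_univ_sum, Fintype.piFinset_univ] at h
  exact h

lemma exists_OPT_eq : ∃ T : (∀ i, I.U i) → Finset (Fin n), (∀ X, T X ∈ I.feas) ∧
    I.OPT = ∑ X, I.realizationProb X *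
      I.f ((T X).image (fun i => (⟨i, X i⟩ : I.Elem))) := by
  choose T hT hTX using fun X : ∀ i, I.U i =>
    Finset.exists_mem_eq_sup' ⟨∅, I.empty_mem_feas⟩
      (fun T => I.f (T.image (fun i => (⟨i, X i⟩ : I.Elem))))
  exact ⟨T, hT, Finset.sum_congr rfl fun X _ => by rw [hTX X]; rfl⟩

lemma le_OPT (T : Finset (Fin n)) (hT : T ∈ I.feas) :
    ∑ X, I.realizationProb X * I.f (T.image (fun i => (⟨i, X i⟩ : I.Elem))) ≤ I.OPT :=
  Finset.sum_le_sum fun X _ => mul_le_mul_of_nonneg_left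
    (Finset.le_sup' (fun T => I.f (T.image (fun i => (⟨i, X i⟩ : I.Elem)))) hT)
    (I.realizationProb_nonneg X)

lemma OPT_nonneg (h0 : ∀ A, 0 ≤ I.f A) : 0 ≤ I.OPT :=
  (Finset.sum_nonneg fun X _ => mul_nonneg (I.realizationProb_nonneg X) (h0 _)).trans
    (I.le_OPT ∅ I.empty_mem_feas)

/-- Each day contributes at most `OPT`, as the prophet may always take just this day. There are at
most as many days as elements because no range is empty. -/
lemma sum_mul_singleton_le (h0 : ∀ A, 0 ≤ I.f A) (hI : ∀ i, {i} ∈ I.feas) :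
    ∑ a : I.Elem, I.D a.1 a.2 * I.f {a} ≤ Fintype.card I.Elem * I.OPT := by
  have h1 : ∀ i, ∑ e, I.D i e * I.f {⟨i, e⟩} ≤ I.OPT := by
    intro i
    rw [← I.sum_realizationProb_mul i fun e => I.f {⟨i, e⟩}]
    simpa using I.le_OPT {i} (hI i)
  have h2 : (n : ℝ) ≤ Fintype.card I.Elem := by
    have : n ≤ Fintype.card I.Elem := by
      have hne : ∀ i, Nonempty (I.U i) := fun i => by
        by_contra h
        rw [not_nonempty_iff] at h
        simpa using (I.D_mem i).2
      have := Fintype.card_le_of_injective (fun i => (⟨i, (hne i).some⟩ : I.Elem))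
        fun i j h => congrArg Sigma.fst h
      simpa using this
    exact_mod_cast this
  rw [Fintype.sum_sigma]
  refine (Finset.sum_le_sum fun i _ => h1 i).trans ?_
  simpa using mul_le_mul_of_nonneg_right h2 (I.OPT_nonneg h0)

/-- The marginals of the prophet's choice form a point of the relaxation in whose direction the
multilinear extension grows quickly. -/
lemma exists_mem_relaxation_OPT_le (hm : Monotone I.f) (hs : IsSubmodular I.f)
    {P : Set (Fin n → ℝ)} (hP : IsPolyhedralRelaxation I.feas P) {x : I.Elem → ℝ}
    (hx : ∀ a, x a ∈ Set.Icc (0 : ℝ) 1) :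
    ∃ y ∈ I.relaxation P, I.OPT ≤ multilinear I.f x + ∑ a, y a * multilinearGrad I.f x a := by
  obtain ⟨T, hT, hOPT⟩ := I.exists_OPT_eq
  set y : I.Elem → ℝ := fun a =>
    ∑ X, I.realizationProb X * if a.1 ∈ T X ∧ X a.1 = a.2 then 1 else 0 with hy
  have hyD : ∀ a : I.Elem, y a ≤ I.D a.1 a.2 := by
    intro a
    have h := I.sum_realizationProb_mul a.1 fun e => if e = a.2 then 1 else 0
    simp only [mul_ite, mul_one, mul_zero, Finset.sum_ite_eq', Finset.mem_univ, if_true] at h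
    rw [← h]
    refine Finset.sum_le_sum fun X _ => ?_
    have := I.realizationProb_nonneg X
    by_cases h1 : X a.1 = a.2 <;> by_cases h2 : a.1 ∈ T X <;> simp [h1, h2, this]
  refine ⟨y, ⟨fun a => ⟨Finset.sum_nonneg fun X _ => mul_nonneg (I.realizationProb_nonneg X)
    (by positivity), (hyD a).trans ?_⟩, ?_, hyD⟩, ?_⟩
  · rw [← (I.D_mem a.1).2]
    exact Finset.single_le_sum (fun e _ => (I.D_mem a.1).1 e) (Finset.mem_univ a.2)
  · have h : (fun i => ∑ e : I.U i, y ⟨i, e⟩) =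
        ∑ X, I.realizationProb X • fun i => if i ∈ T X then (1 : ℝ) else 0 := by
      funext i
      simp only [hy, Finset.sum_apply, Pi.smul_apply, smul_eq_mul]
      rw [Finset.sum_comm]
      refine Finset.sum_congr rfl fun X _ => ?_
      rw [← Finset.mul_sum]
      by_cases h1 : i ∈ T X <;> simp [h1]
    rw [h]
    exact hP.convex.sum_mem (fun X _ => I.realizationProb_nonneg X) I.sum_realizationProb
      fun X _ => hP.indicator_mem _ (hT X)
  · have h1 : ∀ O : Finset I.Elem,
        I.f O ≤ multilinear I.f x + ∑ a ∈ O, multilinearGrad I.f x a := by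
      intro O
      have := multilinear_mono hx fun R => hs.le_add_sum_marginal hm R O
      rw [multilinear_const, multilinear_add, multilinear_sum] at this
      simpa only [multilinearGrad_eq] using this
    rw [hOPT]
    refine (Finset.sum_le_sum fun X _ => mul_le_mul_of_nonneg_left (h1 _)
      (I.realizationProb_nonneg X)).trans (le_of_eq ?_)
    simp only [mul_add, Finset.sum_add_distrib, ← Finset.sum_mul, I.sum_realizationProb, one_mul]
    congr 1
    simp only [hy, Finset.sum_mul]
    rw [Finset.sum_comm]
    refine Finset.sum_congr rfl fun X _ => ?_
    have hmem : ∀ a : I.Elem, (a ∈ (T X).image fun i => (⟨i, X i⟩ : I.Elem)) ↔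
        a.1 ∈ T X ∧ X a.1 = a.2 := by
      rintro ⟨i, e⟩
      simp only [Finset.mem_image, Sigma.mk.injEq]
      constructor
      · rintro ⟨j, hj, rfl, h⟩
        exact ⟨hj, eq_of_heq h⟩
      · rintro ⟨h1, h2⟩
        exact ⟨i, h1, rfl, heq_of_eq h2⟩
    rw [Finset.mul_sum]
    refine (Finset.sum_congr rfl fun a ha => ?_).trans
      (Finset.sum_subset (Finset.subset_univ _) fun a _ ha => ?_)
    · rw [if_pos ((hmem a).1 ha), mul_one]
    · rw [if_neg fun h => ha ((hmem a).2 h), mul_zero, zero_mul]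

/-- The value of the point computed by continuous greedy, with an error relative to `b`. -/
lemma OPT_le_multilinear (h0 : ∀ A, 0 ≤ I.f A) (hm : Monotone I.f)
    (hs : IsSubmodular I.f) {P : Set (Fin n → ℝ)} (hP : IsPolyhedralRelaxation I.feas P)
    (hI : ∀ i, {i} ∈ I.feas) {b δ : ℝ} (hb : b ∈ Set.Icc (0 : ℝ) 1) (hδ : 0 ≤ δ) {N : ℕ}
    (hN : 0 < N) {z : I.Elem → ℝ}
    (h : IsContinuousGreedyOutput I.f (I.relaxation P) b N δ z) :
    (1 - Real.exp (-b) -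
      b * (2 * δ * Fintype.card I.Elem + (Fintype.card I.Elem : ℝ) ^ 2 / N)) * I.OPT ≤
      multilinear I.f z :=
  h.le_multilinear h0 hm hs le_rfl (I.OPT_nonneg h0) (fun _ hv a => ⟨hv.1 a, hv.2.2 a⟩)
    (I.sum_mul_singleton_le h0 hI)
    (fun _ hx => I.exists_mem_relaxation_OPT_le hm hs hP hx) hb hδ hN

lemma split_OPT (k : ∀ i, I.U i → ℕ+) : (I.split k).OPT = I.OPT := by
  have h := sum_prod_mul_comp (κ := (I.split k).U) (κ' := I.U) (I.split k).D
    (fun i a => a.1) (fun X => I.feas.sup' ⟨∅, I.empty_mem_feas⟩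
      (fun T => I.f (T.image (fun i => (⟨i, X i⟩ : I.Elem)))))
  have hD : ∀ i (e : I.U i), (∑ a : (I.split k).U i,
      if a.1 = e then (I.split k).D i a else 0) = I.D i e := by
    intro i e
    show (∑ a : Σ e : I.U i, Fin (k i e), if a.1 = e then I.D i a.1 / (k i a.1 : ℕ) else 0) = _
    have hk : ((k i e : ℕ) : ℝ) ≠ 0 := Nat.cast_ne_zero.mpr (k i e).ne_zero
    rw [Fintype.sum_sigma, Finset.sum_eq_single e]
    · simp only [if_true, Finset.sum_const, Finset.card_univ, Fintype.card_fin, nsmul_eq_mul]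
      field_simp
    · intro e' _ he'
      simp [he']
    · simp
  simp only [hD] at h
  rw [OPT, OPT, ← h]
  refine Finset.sum_congr rfl fun X _ => ?_
  congr 1
  refine Finset.sup'_congr _ rfl fun T _ => ?_
  show I.f ((T.image fun i => (⟨i, X i⟩ : (I.split k).Elem)).image fun a => ⟨a.1, a.2.1⟩) = _
  rw [Finset.image_image]
  rfl

lemma split_monotone (k : ∀ i, I.U i → ℕ+) (hm : Monotone I.f) : Monotone (I.split k).f :=
  fun _ _ h => hm (Finset.image_subset_image h)

/-- Merging commutes with unions but only shrinks intersections: two sets may contain different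
copies of one element. Monotonicity of `f` covers this. -/
lemma split_isSubmodular (k : ∀ i, I.U i → ℕ+) (hm : Monotone I.f) (hs : IsSubmodular I.f) :
    IsSubmodular (I.split k).f := by
  intro A B
  have h := hs (I.merge k A) (I.merge k B)
  have h1 : I.merge k (A ∪ B) = I.merge k A ∪ I.merge k B := Finset.image_union _ _
  have h2 : I.merge k (A ∩ B) ⊆ I.merge k A ∩ I.merge k B := Finset.image_inter_subset _ _ _
  have h3 := hm h2
  rw [← h1] at h
  show I.f (I.merge k (A ∪ B)) + I.f (I.merge k (A ∩ B)) ≤ I.f (I.merge k A) + I.f (I.merge k B)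
  linarith

end Instance

end SubmodularProphet

/-! ### The joint law of the sets `T i` and the family of the OCRS -/

namespace SubmodularProphet

section SetLaw

variable {α : Type*} [Fintype α] [DecidableEq α] {x : α → ℝ}

lemma prodProb_singleton_le (hx : ∀ e, x e ∈ Set.Icc (0 : ℝ) 1) (e : α) :
    prodProb x {e} ≤ x e := by
  rw [prodProb, Finset.prod_singleton]
  exact mul_le_of_le_one_right (hx e).1 (Finset.prod_le_one (fun a _ => sub_nonneg.2 (hx a).2)
    fun a _ => sub_le_self _ (hx a).1)

lemma prodProb_empty (x : α → ℝ) : prodProb x ∅ = ∏ e, (1 - x e) := by simp [prodProb]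

lemma sum_prodProb_singleton_add (x : α → ℝ) :
    ∑ e, prodProb x {e} +
      ∑ R ∈ Finset.univ.filter (fun R : Finset α => R.card ≠ 1), prodProb x R = 1 := by
  rw [← sum_prodProb x, ← Finset.sum_filter_add_sum_filter_not Finset.univ
    (fun R : Finset α => R.card = 1)]
  congr 1
  rw [Finset.univ_filter_card_eq, Finset.powersetCard_one, Finset.sum_map]
  rfl

lemma sum_prodProb_card_ne_one_pos (hx : ∀ e, 0 ≤ x e) (hx1 : ∀ e, x e < 1) :
    0 < ∑ R ∈ Finset.univ.filter (fun R : Finset α => R.card ≠ 1), prodProb x R := by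
  refine Finset.sum_pos' (fun R _ => prodProb_nonneg (fun e => ⟨hx e, (hx1 e).le⟩) R)
    ⟨∅, by simp, ?_⟩
  rw [prodProb_empty]
  exact Finset.prod_pos fun e _ => sub_pos.2 (hx1 e)

end SetLaw

/-- A lower bound for the probability that `R ∼ x` is empty. -/
lemma exp_neg_sub_le_prod_one_sub {α : Type*} [Fintype α] {x : α → ℝ} {b η : ℝ}
    (hb : b ∈ Set.Icc (0 : ℝ) 1) (hη : 0 ≤ η) (hη2 : η ≤ 1 / 2) (hx : ∀ e, 0 ≤ x e)
    (hxη : ∀ e, x e ≤ η) (hxb : ∑ e, x e ≤ b) :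
    Real.exp (-b) - 2 * η ≤ ∏ e, (1 - x e) := by
  -- Here `1 / (1 - x) ≤ 1 + x * (1 + 2 * η) ≤ exp (x * (1 + 2 * η))`; the first inequality amounts
  -- to `x * (1 + 2 * η) ≤ 2 * η`, true for `x ≤ η ≤ 1 / 2`.
  have h1 : ∀ e, Real.exp (-(x e * (1 + 2 * η))) ≤ 1 - x e := by
    intro e
    have hpos : 0 < 1 - x e := by linarith [hxη e]
    rw [Real.exp_neg, inv_le_comm₀ (Real.exp_pos _) hpos]
    have h2 := Real.add_one_le_exp (x e * (1 + 2 * η))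
    refine le_trans ?_ h2
    rw [inv_le_iff_one_le_mul₀ hpos]
    nlinarith [hx e, hxη e, mul_nonneg (hx e) (sub_nonneg.2 (hxη e)), mul_nonneg (hx e) hη,
      mul_nonneg (mul_nonneg (hx e) hη) (sub_nonneg.2 ((hxη e).trans hη2))]
  have h2 : Real.exp (-(b * (1 + 2 * η))) ≤ ∏ e, (1 - x e) := by
    refine le_trans ?_ (Finset.prod_le_prod (fun e _ => (Real.exp_pos _).le) fun e _ => h1 e)
    rw [← Real.exp_sum, Real.exp_le_exp, Finset.sum_neg_distrib, ← Finset.sum_mul]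
    have := mul_le_mul_of_nonneg_right hxb (by linarith : 0 ≤ 1 + 2 * η)
    linarith
  refine le_trans ?_ h2
  have h3 : -(b * (1 + 2 * η)) = -b + -(2 * η * b) := by ring
  have h4 := Real.one_sub_le_exp_neg (2 * η * b)
  have h5 : Real.exp (-b) ≤ 1 := Real.exp_le_one_iff.2 (by linarith [hb.1])
  have h6 := mul_le_mul_of_nonneg_left h4 (Real.exp_pos (-b)).le
  have h7 : 2 * η * b ≤ 2 * η := mul_le_of_le_one_right (by linarith) hb.2
  have h8 : 0 ≤ 2 * η * b := mul_nonneg (by linarith) hb.1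
  have h9 := mul_le_mul_of_nonneg_right h5 h8
  rw [h3, Real.exp_add]
  linarith

namespace Instance

variable {n : ℕ} (I : Instance.{u} n)

section Law

variable {I} {z : I.Elem → ℝ}

lemma setLaw_nonneg (hz : ∀ a, 0 ≤ z a) (hz1 : ∀ a, z a < 1) (hzD : ∀ a, z a ≤ I.D a.1 a.2)
    (i : Fin n) (e : I.U i) (S : Finset (I.U i)) : 0 ≤ I.setLaw z i e S := by
  have hx : ∀ e, I.dayPart z i e ∈ Set.Icc (0 : ℝ) 1 := fun e => ⟨hz _, (hz1 _).le⟩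
  have hp : prodProb (I.dayPart z i) {e} / I.D i e ∈ Set.Icc (0 : ℝ) 1 :=
    ⟨div_nonneg (prodProb_nonneg hx _) ((I.D_mem i).1 e),
      div_le_one_of_le₀ ((prodProb_singleton_le hx e).trans (hzD ⟨i, e⟩)) ((I.D_mem i).1 e)⟩
  have hQ := sum_prodProb_card_ne_one_pos (x := I.dayPart z i) (fun e => hz _) (fun e => hz1 _)
  refine add_nonneg ?_ (mul_nonneg (sub_nonneg.2 hp.2) ?_)
  · split_ifs
    exacts [hp.1, le_rfl]
  · split_ifs
    exacts [div_nonneg (prodProb_nonneg hx _) hQ.le, le_rfl]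

lemma eq_of_setLaw_ne_zero {i : Fin n} {e e' : I.U i} (h : I.setLaw z i e {e'} ≠ 0) : e' = e := by
  by_contra hne
  exact h (by simp [setLaw, hne])

/-- Averaged over the realization, the random set of a day is distributed as `R ∼ z_i`. -/
lemma sum_mul_setLaw (hz : ∀ a, 0 ≤ z a) (hz1 : ∀ a, z a < 1) (hzD : ∀ a, z a ≤ I.D a.1 a.2)
    (i : Fin n) (S : Finset (I.U i)) :
    ∑ e, I.D i e * I.setLaw z i e S = prodProb (I.dayPart z i) S := by
  have hx : ∀ e, I.dayPart z i e ∈ Set.Icc (0 : ℝ) 1 := fun e => ⟨hz _, (hz1 _).le⟩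
  have hDp : ∀ e, I.D i e * (prodProb (I.dayPart z i) {e} / I.D i e) =
      prodProb (I.dayPart z i) {e} := by
    -- If `D i e = 0`, the division returns `0`, which is correct since `z ≤ D` forces the singleton
    -- to have probability `0`.
    intro e
    by_cases h : I.D i e = 0
    · have h1 : prodProb (I.dayPart z i) {e} ≤ 0 :=
        (prodProb_singleton_le hx e).trans ((hzD ⟨i, e⟩).trans h.le)
      rw [h, zero_mul, le_antisymm h1 (prodProb_nonneg hx _)]
    · exact mul_div_cancel₀ _ h
  by_cases hS : S.card = 1
  · obtain ⟨e₀, rfl⟩ := Finset.card_eq_one.1 hS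
    rw [Finset.sum_eq_single e₀]
    · simp [setLaw, hDp]
    · intro e _ he
      simp [setLaw, he.symm]
    · simp
  · have hQ := sum_prodProb_card_ne_one_pos (x := I.dayPart z i) (fun e => hz _) (fun e => hz1 _)
    have hsum := sum_prodProb_singleton_add (I.dayPart z i)
    set Q := ∑ R ∈ Finset.univ.filter (fun R : Finset (I.U i) => R.card ≠ 1),
      prodProb (I.dayPart z i) R with hQdef
    -- The probability left over for non-singletons is `D i e` minus that of `{e}`. Summed over `e`
    -- it equals `Q`, which cancels the conditioning.
    have h1 : ∀ e, I.D i e * I.setLaw z i e S =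
        (I.D i e - prodProb (I.dayPart z i) {e}) * (prodProb (I.dayPart z i) S / Q) := by
      intro e
      have hne : S ≠ {e} := fun h => hS (by rw [h, Finset.card_singleton])
      simp only [setLaw, hne, if_false, hS, ne_eq, not_false_eq_true, if_true, zero_add]
      rw [← mul_assoc, mul_sub, mul_one, hDp]
    rw [Finset.sum_congr rfl fun e _ => h1 e, ← Finset.sum_mul, Finset.sum_sub_distrib,
      (I.D_mem i).2, ← hsum, add_sub_cancel_left, mul_div_cancel₀ _ hQ.ne']

end Law

/-- Sets of elements correspond to families of sets of elements of the days. -/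
def sigmaFinsetEquiv : (∀ i, Finset (I.U i)) ≃ Finset I.Elem where
  toFun T := Finset.univ.sigma T
  invFun R i := Finset.univ.filter fun e => (⟨i, e⟩ : I.Elem) ∈ R
  left_inv T := by ext; simp
  right_inv R := by ext; simp

lemma prodProb_sigma (z : I.Elem → ℝ) (T : ∀ i, Finset (I.U i)) :
    prodProb z (Finset.univ.sigma T) = ∏ i, prodProb (I.dayPart z i) (T i) := by
  simp only [prodProb_eq_prod_ite]
  rw [Fintype.prod_sigma]
  simp [dayPart]

lemma multilinear_eq_sum_sigma (z : I.Elem → ℝ) (g : Finset I.Elem → ℝ) :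
    multilinear g z =
      ∑ T : ∀ i, Finset (I.U i), (∏ i, prodProb (I.dayPart z i) (T i)) * g (Finset.univ.sigma T) := by
  rw [multilinear, ← I.sigmaFinsetEquiv.sum_comp]
  refine Finset.sum_congr rfl fun T _ => ?_
  rw [← prodProb_sigma]
  rfl

lemma sum_outcome (g : I.Outcome → ℝ) :
    ∑ ω, g ω = ∑ 𝓕, ∑ T : ∀ i, Finset (I.U i), ∑ X : ∀ i, I.U i, g ⟨X, T, 𝓕⟩ := by
  rw [← I.outcomeEquiv.symm.sum_comp, Fintype.sum_prod_type]
  simp only [Fintype.sum_prod_type]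
  rw [Finset.sum_comm]
  conv_lhs => enter [2, T]; rw [Finset.sum_comm]
  rw [Finset.sum_comm]
  rfl

/-- The set of the elements drawn on the days and the family drawn by the OCRS are independent,
and the former is distributed as `R ∼ z`. -/
lemma sum_outcomeProb_mul {P : Set (Fin n → ℝ)} (π : GreedyOCRS I.feas P) {z : I.Elem → ℝ}
    (hz : ∀ a, 0 ≤ z a) (hz1 : ∀ a, z a < 1) (hzD : ∀ a, z a ≤ I.D a.1 a.2)
    (G : Finset (Finset (Fin n)) → Finset I.Elem → ℝ) :
    ∑ ω, I.outcomeProb π z ω * G ω.family (Finset.univ.sigma ω.T) =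
      ∑ 𝓕, π.law (I.ocrsInput z) 𝓕 * multilinear (G 𝓕) z := by
  rw [sum_outcome]
  refine Finset.sum_congr rfl fun 𝓕 _ => ?_
  rw [multilinear_eq_sum_sigma, Finset.mul_sum]
  refine Finset.sum_congr rfl fun T _ => ?_
  have h : ∑ X : ∀ i, I.U i, ∏ i, I.D i (X i) * I.setLaw z i (X i) (T i) =
      ∏ i, prodProb (I.dayPart z i) (T i) := by
    simp only [← sum_mul_setLaw hz hz1 hzD]
    rw [Finset.prod_univ_sum, Fintype.piFinset_univ]
  rw [← h, Finset.sum_mul, Finset.mul_sum]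
  refine Finset.sum_congr rfl fun X _ => ?_
  simp only [outcomeProb]
  ring

lemma outcomeProb_mem_stdSimplex {P : Set (Fin n → ℝ)} (π : GreedyOCRS I.feas P)
    {z : I.Elem → ℝ} (hz : ∀ a, 0 ≤ z a) (hz1 : ∀ a, z a < 1) (hzD : ∀ a, z a ≤ I.D a.1 a.2)
    (hx : I.ocrsInput z ∈ P) : I.outcomeProb π z ∈ stdSimplex ℝ I.Outcome := by
  refine ⟨fun ω => mul_nonneg (Finset.prod_nonneg fun i _ => mul_nonneg ((I.D_mem i).1 _)
    (setLaw_nonneg hz hz1 hzD _ _ _)) ((π.law_mem _ hx).1 _), ?_⟩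
  have h := I.sum_outcomeProb_mul π hz hz1 hzD fun _ _ => 1
  simpa [multilinear_const, (π.law_mem _ hx).2] using h

/-- The set of the days that have an element in `R ∼ z` is distributed according to the vector
given to the OCRS. -/
lemma multilinear_image_fst (z : I.Elem → ℝ) (G : Finset (Fin n) → ℝ) :
    multilinear (fun R : Finset I.Elem => G (R.image Sigma.fst)) z =
      multilinear G (I.ocrsInput z) := by
  have h := sum_prod_mul_comp (κ := fun i => Finset (I.U i)) (κ' := fun _ : Fin n => Bool)
    (fun i S => prodProb (I.dayPart z i) S) (fun i S => decide (S ≠ ∅))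
    (fun Y => G (Finset.univ.filter fun i => Y i = true))
  have himg : ∀ T : ∀ i, Finset (I.U i), (Finset.univ.sigma T).image Sigma.fst =
      Finset.univ.filter fun i => decide (T i ≠ ∅) = true := by
    intro T
    ext i
    simp [← Finset.nonempty_iff_ne_empty, Finset.Nonempty]
  rw [multilinear_eq_sum_sigma]
  simp only [himg]
  rw [h, multilinear]
  let E : (Fin n → Bool) ≃ Finset (Fin n) :=
    { toFun := fun Y => Finset.univ.filter fun i => Y i = true
      invFun := fun B i => decide (i ∈ B)
      left_inv := fun Y => by ext; simp
      right_inv := fun B => by ext; simp }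
  rw [← E.sum_comp]
  refine Finset.sum_congr rfl fun Y _ => ?_
  congr 1
  rw [prodProb_eq_prod_ite]
  refine Finset.prod_congr rfl fun i _ => ?_
  have h1 := Finset.add_sum_erase Finset.univ (fun S => prodProb (I.dayPart z i) S)
    (Finset.mem_univ ∅)
  simp only [sum_prodProb, prodProb_empty] at h1
  have h2 : Finset.univ.filter (fun S : Finset (I.U i) => S ≠ ∅) = Finset.univ.erase ∅ := by
    ext; simp
  cases hY : Y i
  · simp [E, hY, ocrsInput, prodProb_empty]
  · simp only [E, hY, Equiv.coe_fn_mk, Finset.mem_filter, Finset.mem_univ, true_and, if_true,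
      decide_eq_true_eq, ocrsInput]
    rw [← Finset.sum_filter, h2]
    linarith

end Instance

end SubmodularProphet

namespace SubmodularProphet

/-! ### Rounding against the almighty adversary -/

namespace Instance

variable {n : ℕ} (I : Instance.{u} n)

lemma ocrsInput_nonneg {z : I.Elem → ℝ} (hz : ∀ a, z a ∈ Set.Icc (0 : ℝ) 1) :
    0 ≤ I.ocrsInput z := fun _ =>
  sub_nonneg.2 (Finset.prod_le_one (fun _ _ => sub_nonneg.2 (hz _).2)
    fun _ _ => sub_le_self _ (hz _).1)

lemma ocrsInput_le_sum {z : I.Elem → ℝ} (hz : ∀ a, z a ∈ Set.Icc (0 : ℝ) 1) (i : Fin n) :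
    I.ocrsInput z i ≤ ∑ e, z ⟨i, e⟩ := by
  have h : ∀ U : Finset (I.U i), 1 - ∑ e ∈ U, z ⟨i, e⟩ ≤ ∏ e ∈ U, (1 - z ⟨i, e⟩) := by
    intro U
    induction U using Finset.induction_on with
    | empty => simp
    | insert e U he ih =>
      rw [Finset.sum_insert he, Finset.prod_insert he]
      have h1 := mul_le_mul_of_nonneg_left ih (sub_nonneg.2 (hz ⟨i, e⟩).2)
      have h2 := mul_nonneg (hz ⟨i, e⟩).1 (Finset.sum_nonneg fun e' (_ : e' ∈ U) => (hz ⟨i, e'⟩).1)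
      linarith
  have := h Finset.univ
  simp only [ocrsInput, dayPart]
  linarith

lemma ocrsInput_mem_smul {P : Set (Fin n → ℝ)} (hP : IsDownwardClosed P) {b : ℝ} (hb : 0 ≤ b)
    {z : I.Elem → ℝ} (hz1 : ∀ a, z a ∈ Set.Icc (0 : ℝ) 1) (hz : z ∈ b • I.relaxation P) :
    I.ocrsInput z ∈ b • P := by
  obtain ⟨y, ⟨-, hy, -⟩, rfl⟩ := hz
  have h0 := I.ocrsInput_nonneg hz1
  have hle : ∀ i, I.ocrsInput (b • y) i ≤ b * ∑ e, y ⟨i, e⟩ := fun i => by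
    simpa [Finset.mul_sum] using I.ocrsInput_le_sum hz1 i
  -- For `b = 0` one cannot rescale by `b⁻¹`, but then the input of the OCRS is `0`.
  rcases hb.eq_or_lt with rfl | hb
  · refine ⟨_, hy, ?_⟩
    funext i
    have h1 := hle i
    rw [zero_mul] at h1
    simpa using (le_antisymm h1 (h0 i)).symm
  · refine ⟨b⁻¹ • I.ocrsInput (b • y), hP _ hy _ (smul_nonneg (inv_nonneg.2 hb.le) h0)
      fun i => ?_, smul_inv_smul₀ hb.ne' _⟩
    simp only [Pi.smul_apply, smul_eq_mul]
    rw [inv_mul_le_iff₀ hb]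
    exact hle i

/-- The greedy OCRS selects day `i` for every order of arrival, provided that it is fed with it:
no set of selected days blocks `i`. -/
def Unblocked (𝓕 : Finset (Finset (Fin n))) (A : Finset (Fin n)) (i : Fin n) : Prop :=
  ∀ J ∈ A.powerset, J ∈ 𝓕 → insert i J ∈ 𝓕

instance (𝓕 : Finset (Finset (Fin n))) (A : Finset (Fin n)) (i : Fin n) :
    Decidable (Unblocked 𝓕 A i) := inferInstanceAs (Decidable (∀ J ∈ A.powerset, _))

lemma Unblocked.mono {𝓕 : Finset (Finset (Fin n))} {A B : Finset (Fin n)} {i : Fin n}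
    (h : A ⊆ B) (hB : Unblocked 𝓕 B i) : Unblocked 𝓕 A i :=
  fun J hJ => hB J (Finset.powerset_mono.2 h hJ)

/-- Whether `i` is blocked does not depend on `i` itself being active, as contention resolution
requires. -/
lemma Unblocked.insert {𝓕 : Finset (Finset (Fin n))} {A : Finset (Fin n)} {i : Fin n}
    (h : Unblocked 𝓕 A i) : Unblocked 𝓕 (insert i A) i := by
  intro J hJ hJ𝓕
  by_cases hi : i ∈ J
  · rwa [Finset.insert_eq_of_mem hi]
  · exact h J (Finset.mem_powerset.2 ((Finset.subset_insert_iff_of_notMem hi).1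
      (Finset.mem_powerset.1 hJ))) hJ𝓕

section Fold

variable {I} (ω : I.Outcome)

/-- What holds for the selected days and the current solution throughout the algorithm. -/
structure Invariant (s : Finset (Fin n) × Finset I.Elem) : Prop where
  mem_family : s.1 ∈ ω.family
  subset_active : s.1 ⊆ (Finset.univ.sigma ω.T).image Sigma.fst
  image_subset : s.2.image Sigma.fst ⊆ s.1
  eq_realization : ∀ a ∈ s.2, a.2 = ω.X a.1

lemma mem_active_iff (i : Fin n) :
    i ∈ (Finset.univ.sigma ω.T).image Sigma.fst ↔ ω.T i ≠ ∅ := by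
  simp [← Finset.nonempty_iff_ne_empty, Finset.Nonempty]

variable {ω}

lemma Invariant.step {s : Finset (Fin n) × Finset I.Elem} (h : Invariant ω s) (i : Fin n) :
    Invariant ω (I.step ω s i) := by
  unfold Instance.step
  split_ifs with h1 h2
  · refine ⟨h1.2, Finset.insert_subset ((mem_active_iff ω i).2 h1.1) h.subset_active, ?_, ?_⟩
    · rw [Finset.image_insert]
      exact Finset.insert_subset_insert _ h.image_subset
    · intro a ha
      rcases Finset.mem_insert.1 ha with rfl | ha
      exacts [rfl, h.eq_realization a ha]
  · exact ⟨h1.2, Finset.insert_subset ((mem_active_iff ω i).2 h1.1) h.subset_active,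
      h.image_subset.trans (Finset.subset_insert _ _), h.eq_realization⟩
  · exact h

lemma Invariant.foldl {l : List (Fin n)} {s : Finset (Fin n) × Finset I.Elem}
    (h : Invariant ω s) : Invariant ω (l.foldl (I.step ω) s) := by
  induction l generalizing s with
  | nil => exact h
  | cons i l ih => exact ih (h.step i)

lemma subset_foldl (l : List (Fin n)) (s : Finset (Fin n) × Finset I.Elem) :
    s.2 ⊆ (l.foldl (I.step ω) s).2 := by
  induction l generalizing s with
  | nil => exact subset_rfl
  | cons i l ih =>
    refine Finset.Subset.trans ?_ (ih _)
    unfold Instance.step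
    split_ifs
    exacts [Finset.subset_insert _ _, subset_rfl, subset_rfl]

/-- When `i` arrives, the days selected so far are active and form a set of the family, so `hU`
applies to them whatever the order was; nothing is removed later. -/
lemma mem_foldl {l : List (Fin n)} {s : Finset (Fin n) × Finset I.Elem} (h : Invariant ω s)
    {i : Fin n} (hi : i ∈ l) (hT : ω.T i = {ω.X i})
    (hU : Unblocked ω.family ((Finset.univ.sigma ω.T).image Sigma.fst) i) :
    (⟨i, ω.X i⟩ : I.Elem) ∈ (l.foldl (I.step ω) s).2 := by
  induction l generalizing s with
  | nil => simp at hi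
  | cons j l ih =>
    rcases List.mem_cons.1 hi with rfl | hi
    · refine subset_foldl l _ ?_
      have h1 : ω.T i ≠ ∅ := by simp [hT]
      have h2 := hU s.1 (Finset.mem_powerset.2 h.subset_active) h.mem_family
      simp [Instance.step, hT, h2]
    · exact ih (h.step j) hi

lemma invariant_start (h : ∅ ∈ ω.family) : Invariant ω (∅, ∅) :=
  ⟨h, Finset.empty_subset _, by simp, by simp⟩

lemma subset_output (h : ∅ ∈ ω.family) (hT : ∀ i e, ω.T i = {e} → e = ω.X i)
    (σ : Equiv.Perm (Fin n)) {a : I.Elem} (ha : ω.T a.1 = {a.2})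
    (hU : Unblocked ω.family ((Finset.univ.sigma ω.T).image Sigma.fst) a.1) :
    a ∈ I.output ω σ := by
  obtain ⟨i, e⟩ := a
  obtain rfl := hT i e ha
  refine mem_foldl (invariant_start h) ?_ ha hU
  exact List.mem_map.2 ⟨σ.symm i, List.mem_finRange _, by simp⟩

end Fold

/-- The element `a` is kept: no other element of its day is in `R`, and its day is not blocked. -/
def Kept (𝓕 : Finset (Finset (Fin n))) (a : I.Elem) (R : Finset I.Elem) : Prop :=
  (∀ e, e ≠ a.2 → (⟨a.1, e⟩ : I.Elem) ∉ R) ∧ Unblocked 𝓕 (R.image Sigma.fst) a.1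

instance (𝓕 : Finset (Finset (Fin n))) (a : I.Elem) (R : Finset I.Elem) :
    Decidable (I.Kept 𝓕 a R) := inferInstanceAs (Decidable (_ ∧ _))

/-- An empty day and an unblocked day are both decreasing events, so Harris applies; together they
imply that `a` is kept. -/
lemma prod_mul_le_multilinear_kept {z : I.Elem → ℝ} (hz : ∀ a, z a ∈ Set.Icc (0 : ℝ) 1)
    (𝓕 : Finset (Finset (Fin n))) (a : I.Elem) :
    (∏ e, (1 - I.dayPart z a.1 e)) *
        multilinear (fun B => if Unblocked 𝓕 B a.1 then (1 : ℝ) else 0) (I.ocrsInput z) ≤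
      multilinear (fun R => if I.Kept 𝓕 a R then (1 : ℝ) else 0) z := by
  have hempty : multilinear (fun B => if a.1 ∈ B then (0 : ℝ) else 1) (I.ocrsInput z) =
      ∏ e, (1 - I.dayPart z a.1 e) := by
    have h1 := multilinear_ite_mem (g := fun _ => 1) (e := a.1) (I.ocrsInput z) fun _ => rfl
    have h2 : (fun B : Finset (Fin n) => if a.1 ∈ B then (0 : ℝ) else 1) =
        fun B => 1 - if a.1 ∈ B then (1 : ℝ) else 0 := by
      funext B; split_ifs <;> simp
    rw [h2, multilinear_sub, h1, multilinear_const, ocrsInput]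
    simp
  rw [← hempty, ← multilinear_image_fst, ← multilinear_image_fst]
  refine (multilinear_mul_ge hz (fun R => by positivity) (fun R => by positivity) ?_ ?_).trans
    (multilinear_mono hz fun R => ?_)
  · intro S T hST
    by_cases h : a.1 ∈ T.image Sigma.fst
    · simp only [h, if_true]; positivity
    · have h' : a.1 ∉ S.image Sigma.fst := fun hS => h (Finset.image_subset_image hST hS)
      simp only [h, h', if_false, le_refl]
  · intro S T hST
    by_cases h : Unblocked 𝓕 (T.image Sigma.fst) a.1
    · have h' := h.mono (Finset.image_subset_image hST)
      simp only [h, h', if_true, le_refl]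
    · simp only [h, if_false]; positivity
  · by_cases h1 : a.1 ∈ R.image Sigma.fst
    · simp only [h1, if_true, zero_mul]; positivity
    · by_cases h2 : Unblocked 𝓕 (R.image Sigma.fst) a.1
      · have h3 : I.Kept 𝓕 a R :=
          ⟨fun e _ he => h1 (Finset.mem_image.2 ⟨_, he, rfl⟩), h2⟩
        simp only [h1, h2, h3, if_true, if_false, mul_one, le_refl]
      · simp only [h2, if_false, mul_zero]; positivity

lemma mul_multilinear_le_sum_output (h0 : ∀ A, 0 ≤ I.f A) (hm : Monotone I.f)
    (hs : IsSubmodular I.f) {P : Set (Fin n → ℝ)} {π : GreedyOCRS I.feas P} {b c γ : ℝ}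
    (hc : c ∈ Set.Icc (0 : ℝ) 1) (hπ : π.IsSelectable b c) {z : I.Elem → ℝ}
    (hz : ∀ a, 0 ≤ z a) (hz1 : ∀ a, z a < 1) (hzD : ∀ a, z a ≤ I.D a.1 a.2)
    (hxb : I.ocrsInput z ∈ b • P) (hxP : I.ocrsInput z ∈ P) (hγ0 : 0 ≤ γ)
    (hγ : ∀ i, γ ≤ ∏ e, (1 - I.dayPart z i e)) (hγ1 : γ ≤ 1) (adv : I.Adversary) :
    c * γ * multilinear I.f z ≤ ∑ ω, I.outcomeProb π z ω * I.f (I.output ω (adv ω)) := by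
  have hzI : ∀ a, z a ∈ Set.Icc (0 : ℝ) 1 := fun a => ⟨hz a, (hz1 a).le⟩
  have hlaw := π.law_mem _ hxP
  refine (le_multilinear_filter (φ := I.Kept) hzI (h0 ∅) hm hs hlaw ?_ ?_
    (mul_le_one₀ hc.2 hγ0 hγ1) ?_).trans ?_
  · rintro 𝓕 a S T hST ⟨h1, h2⟩
    exact ⟨fun e he h => h1 e he (hST h), h2.mono (Finset.image_subset_image hST)⟩
  · rintro 𝓕 a R ⟨h1, h2⟩
    refine ⟨fun e he h => ?_, ?_⟩
    · rcases Finset.mem_insert.1 h with h | h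
      · obtain ⟨i, e'⟩ := a
        exact he (eq_of_heq (Sigma.mk.inj h).2)
      · exact h1 e he h
    · rw [Finset.image_insert]
      exact h2.insert
  · intro a
    have hsel := hπ _ hxb a.1
    have h1 : ∀ 𝓕 : Finset (Finset (Fin n)),
        (∑ R : Finset (Fin n), if ∀ J ∈ R.powerset, J ∈ 𝓕 → insert a.1 J ∈ 𝓕 then
          π.law (I.ocrsInput z) 𝓕 * prodProb (I.ocrsInput z) R else 0) =
        π.law (I.ocrsInput z) 𝓕 *
          multilinear (fun B => if Unblocked 𝓕 B a.1 then (1 : ℝ) else 0) (I.ocrsInput z) := by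
      intro 𝓕
      rw [multilinear, Finset.mul_sum]
      refine Finset.sum_congr rfl fun R _ => ?_
      by_cases h : Unblocked 𝓕 R a.1
      · have h' := h
        unfold Unblocked at h'
        rw [if_pos h', if_pos h, mul_one]
      · have h' := h
        unfold Unblocked at h'
        rw [if_neg h', if_neg h, mul_zero, mul_zero]
    simp only [h1] at hsel
    rw [mul_comm c γ]
    refine (mul_le_mul_of_nonneg_left hsel hγ0).trans ?_
    rw [Finset.mul_sum]
    refine Finset.sum_le_sum fun 𝓕 _ => ?_
    have h2 := I.prod_mul_le_multilinear_kept hzI 𝓕 a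
    have h3 : 0 ≤ multilinear (fun B => if Unblocked 𝓕 B a.1 then (1 : ℝ) else 0)
        (I.ocrsInput z) := by
      rw [← multilinear_image_fst]
      refine (multilinear_const z 0).ge.trans (multilinear_mono hzI fun R => ?_)
      positivity
    have h4 := (mul_le_mul_of_nonneg_right (hγ a.1) h3).trans h2
    have h5 := mul_le_mul_of_nonneg_left h4 (hlaw.1 𝓕)
    linarith
  · rw [← I.sum_outcomeProb_mul π hz hz1 hzD
      fun 𝓕 R => I.f (R.filter fun a => I.Kept 𝓕 a R)]
    refine Finset.sum_le_sum fun ω _ => ?_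
    have hprob := (I.outcomeProb_mem_stdSimplex π hz hz1 hzD hxP).1 ω
    -- Only outcomes of positive probability are sure to have `∅` in the family and to have `T i =
    -- {e}` only for `e = X i`.
    by_cases hω : I.outcomeProb π z ω = 0
    · simp [hω]
    refine mul_le_mul_of_nonneg_left (hm fun a ha => ?_) hprob
    obtain ⟨haT, hkept, hU⟩ := Finset.mem_filter.1 ha
    have h1 := (π.law_support _ hxP _ (right_ne_zero_of_mul hω)).2.1
    have h2 : ∀ i e, ω.T i = {e} → e = ω.X i := by
      intro i e he
      have h3 := Finset.prod_ne_zero_iff.1 (left_ne_zero_of_mul hω) i (Finset.mem_univ i)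
      have h4 := right_ne_zero_of_mul h3
      rw [he] at h4
      exact eq_of_setLaw_ne_zero h4
    refine subset_output h1 h2 _ ?_ hU
    ext e
    rw [Finset.mem_singleton]
    constructor
    · intro he
      by_contra hne
      exact hkept e hne (by simpa using he)
    · rintro rfl
      simpa using haT

lemma output_feasible {P : Set (Fin n → ℝ)} (π : GreedyOCRS I.feas P) {z : I.Elem → ℝ}
    (hxP : I.ocrsInput z ∈ P) {ω : I.Outcome} (hω : I.outcomeProb π z ω ≠ 0)
    (σ : Equiv.Perm (Fin n)) :
    (I.output ω σ).image Sigma.fst ∈ I.feas ∧ ∀ a ∈ I.output ω σ, a.2 = ω.X a.1 := by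
  obtain ⟨h1, h2, -⟩ := π.law_support _ hxP _ (right_ne_zero_of_mul hω)
  have h := (invariant_start h2).foldl (l := (List.finRange n).map σ)
  exact ⟨I.isLowerSet_feas h.image_subset (h1 h.mem_family), h.eq_realization⟩

end Instance

/-- On `[0,1]`, `exp (-b) ≤ 1 / (1 + b) ≤ 1 - b / 2`. This turns an error proportional to `b` into
one relative to `1 - exp (-b)`, uniformly as `b → 0`. -/
lemma half_le_one_sub_exp_neg {b : ℝ} (hb : b ∈ Set.Icc (0 : ℝ) 1) :
    b / 2 ≤ 1 - Real.exp (-b) := by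
  have h1 := Real.add_one_le_exp b
  have hpos : 0 < 1 + b := by linarith [hb.1]
  have h2 : Real.exp (-b) ≤ (1 + b)⁻¹ := by
    rw [Real.exp_neg]
    exact inv_anti₀ hpos (by linarith)
  have h3 : (1 + b)⁻¹ ≤ 1 - b / 2 := by
    rw [inv_le_iff_one_le_mul₀ hpos]
    nlinarith [hb.1, hb.2, mul_nonneg hb.1 (sub_nonneg.2 hb.2)]
  linarith

/-! ### Choice of the constants and conclusion -/

namespace Instance

/-- The bound on the probabilities of the elements for the error `ε`. -/
noncomputable def probBound (ε : ℝ) : ℝ := min (1 / 2) (ε / 4)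

/-- The accuracy of continuous greedy for the error `ε` and `m` elements. -/
noncomputable def accuracy (ε : ℝ) (m : ℕ) : ℝ := ε / (4 * ((m : ℝ) + 1) ^ 2)

variable {n : ℕ} (I : Instance.{u} n)

/-- The guarantees of the algorithm on an instance with small probabilities. -/
theorem algorithm_guarantee {ε : ℝ} (hε : 0 < ε) (h0 : ∀ A, 0 ≤ I.f A) (hm : Monotone I.f)
    (hs : IsSubmodular I.f) {P : Set (Fin n → ℝ)} (hP : IsPolyhedralRelaxation I.feas P)
    (hPd : IsDownwardClosed P) {b c : ℝ} (hb : b ∈ Set.Icc (0 : ℝ) 1)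
    (hc : c ∈ Set.Icc (0 : ℝ) 1) (π : GreedyOCRS I.feas P) (hπ : π.IsSelectable b c)
    (hD : ∀ i e, I.D i e ≤ probBound ε) {N : ℕ} {z : I.Elem → ℝ} (hN : 0 < N)
    (hNδ : 1 / (N : ℝ) ≤ accuracy ε (Fintype.card I.Elem))
    (hz : IsContinuousGreedyOutput I.f (I.relaxation P) b N
      (accuracy ε (Fintype.card I.Elem)) z) :
    z ∈ b • I.relaxation P ∧
      I.outcomeProb π z ∈ stdSimplex ℝ I.Outcome ∧
      (∀ (ω : I.Outcome) (σ : Equiv.Perm (Fin n)), I.outcomeProb π z ω ≠ 0 →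
        (I.output ω σ).image Sigma.fst ∈ I.feas ∧ ∀ a ∈ I.output ω σ, a.2 = ω.X a.1) ∧
      ∀ adv : I.Adversary,
        c * (Real.exp (-b) - ε) * (1 - Real.exp (-b)) * I.OPT ≤
          ∑ ω, I.outcomeProb π z ω * I.f (I.output ω (adv ω)) := by
  have hmem : z ∈ b • I.relaxation P := hz.mem_smul (I.convex_relaxation hP.convex) hN
  have hz0 : ∀ a, 0 ≤ z a := by
    obtain ⟨y, hy, rfl⟩ := hmem
    exact fun a => mul_nonneg hb.1 (hy.1 a).1
  have hzD : ∀ a, z a ≤ I.D a.1 a.2 := by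
    obtain ⟨y, hy, rfl⟩ := hmem
    exact fun a => (mul_le_of_le_one_left (hy.1 a).1 hb.2).trans (hy.2.2 a)
  have hzb : ∀ i, ∑ e, z ⟨i, e⟩ ≤ b := by
    obtain ⟨y, hy, rfl⟩ := hmem
    intro i
    simp only [Pi.smul_apply, smul_eq_mul, ← Finset.mul_sum]
    exact mul_le_of_le_one_right hb.1 (hP.subset_cube _ hy.2.1 i).2
  have hη2 : probBound ε ≤ 1 / 2 := min_le_left _ _
  have hη4 : probBound ε ≤ ε / 4 := min_le_right _ _
  have hη0 : 0 ≤ probBound ε := le_min (by norm_num) (by linarith)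
  have hzη : ∀ a, z a ≤ probBound ε := fun a => (hzD a).trans (hD _ _)
  have hz1 : ∀ a, z a < 1 := fun a => by linarith [hzη a]
  have hzI : ∀ a, z a ∈ Set.Icc (0 : ℝ) 1 := fun a => ⟨hz0 a, (hz1 a).le⟩
  have hxb := I.ocrsInput_mem_smul hPd hb.1 hzI hmem
  have hxP : I.ocrsInput z ∈ P := by
    obtain ⟨y, hy, hyx⟩ := hxb
    have hy0 : 0 ≤ y := fun i => (hP.subset_cube y hy i).1
    rw [← hyx]
    exact hPd y hy _ (smul_nonneg hb.1 hy0) fun i => mul_le_of_le_one_left (hy0 i) hb.2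
  have hsimplex := I.outcomeProb_mem_stdSimplex π hz0 hz1 hzD hxP
  refine ⟨hmem, hsimplex, fun ω σ hω => I.output_feasible π hxP hω σ, fun adv => ?_⟩
  have hrhs : 0 ≤ ∑ ω, I.outcomeProb π z ω * I.f (I.output ω (adv ω)) :=
    Finset.sum_nonneg fun ω _ => mul_nonneg (hsimplex.1 ω) (h0 _)
  have hOPT := I.OPT_nonneg h0
  have hE : 0 ≤ 1 - Real.exp (-b) := by linarith [half_le_one_sub_exp_neg hb, hb.1]
  -- For `c = 0` the bound is trivial; `c > 0` is needed to make all singletons feasible.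
  rcases hc.1.eq_or_lt with rfl | hcpos
  · simpa using hrhs
  rcases le_or_gt (Real.exp (-b) - ε) 0 with hneg | hpos
  · refine le_trans ?_ hrhs
    exact mul_nonpos_of_nonpos_of_nonneg (mul_nonpos_of_nonpos_of_nonneg
      (mul_nonpos_of_nonneg_of_nonpos hc.1 hneg) hE) hOPT
  set γ : ℝ := Real.exp (-b) - 2 * probBound ε with hγdef
  have hγ0 : 0 ≤ γ := by linarith
  have hγ1 : γ ≤ 1 := by
    have : Real.exp (-b) ≤ 1 := Real.exp_le_one_iff.2 (by linarith [hb.1])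
    linarith
  have hγ : ∀ i, γ ≤ ∏ e, (1 - I.dayPart z i e) := fun i =>
    exp_neg_sub_le_prod_one_sub hb hη0 hη2 (fun e => hz0 _) (fun e => hzη _) (hzb i)
  refine le_trans ?_ (I.mul_multilinear_le_sum_output h0 hm hs hc hπ hz0 hz1 hzD hxb hxP hγ0 hγ
    hγ1 adv)
  have hfeas : ∀ i, {i} ∈ I.feas :=
    hπ.singleton_mem (hP.zero_mem I.empty_mem_feas) hcpos
  set m : ℝ := (Fintype.card I.Elem : ℝ) with hmdef
  have hm0 : 0 ≤ m := Nat.cast_nonneg _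
  set δ : ℝ := accuracy ε (Fintype.card I.Elem) with hδdef
  have hδ : δ * (m + 1) ^ 2 = ε / 4 := by
    rw [hδdef, accuracy, ← hmdef]
    field_simp
  have hδ0 : 0 ≤ δ := by rw [hδdef, accuracy]; positivity
  have hF := I.OPT_le_multilinear h0 hm hs hP hfeas hb hδ0 hN hz
  -- As `1 / N ≤ δ`, the left side is at most `δ * (2 * m + m ^ 2) ≤ δ * (m + 1) ^ 2`.
  have herr : 2 * δ * m + m ^ 2 / N ≤ ε / 4 := by
    have h1 := mul_le_mul_of_nonneg_left hNδ (sq_nonneg m)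
    rw [mul_one_div] at h1
    nlinarith
  have hbE : b * (2 * δ * m + m ^ 2 / N) ≤ ε / 2 * (1 - Real.exp (-b)) := by
    have h1 := mul_le_mul_of_nonneg_left herr hb.1
    have h2 := mul_le_mul_of_nonneg_right (half_le_one_sub_exp_neg hb) hε.le
    linarith
  have hF' : (1 - ε / 2) * (1 - Real.exp (-b)) * I.OPT ≤ multilinear I.f z := by
    refine le_trans (mul_le_mul_of_nonneg_right ?_ hOPT) hF
    linarith
  -- Half of `ε` pays for `2 * probBound ε ≤ ε / 2`, the other half for the error of continuous
  -- greedy.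
  have hγε : Real.exp (-b) - ε ≤ γ * (1 - ε / 2) := by
    have : γ * (ε / 2) ≤ ε / 2 := mul_le_of_le_one_left (by linarith) hγ1
    linarith
  have h1 := mul_le_mul_of_nonneg_left hF' (mul_nonneg hc.1 hγ0)
  have h2 := mul_le_mul_of_nonneg_right hγε (mul_nonneg (mul_nonneg hc.1 hE) hOPT)
  linarith

end Instance

end SubmodularProphet

open SubmodularProphet in
theorem mainTheorem4 (ε : ℝ) (hε : 0 < ε) :
    ∃ ε' : ℝ, 0 < ε' ∧ ∃ δ : ℕ → ℝ, (∀ m, 0 < δ m) ∧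
      ∀ (n : ℕ) (I : Instance.{u} n),
        (∀ A, 0 ≤ I.f A) → Monotone I.f → IsSubmodular I.f →
      ∀ P : Set (Fin n → ℝ), IsPolyhedralRelaxation I.feas P → IsDownwardClosed P →
      ∀ b c : ℝ, b ∈ Set.Icc (0 : ℝ) 1 → c ∈ Set.Icc (0 : ℝ) 1 →
      ∀ π : GreedyOCRS I.feas P, π.IsSelectable b c →
        -- the algorithm on an instance with small probabilities
        ((∀ i e, I.D i e ≤ ε') →
          ∀ (N : ℕ) (z : I.Elem → ℝ), 0 < N →
            1 / (N : ℝ) ≤ δ (Fintype.card I.Elem) →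
            IsContinuousGreedyOutput I.f (I.relaxation P) b N (δ (Fintype.card I.Elem)) z →
            z ∈ b • I.relaxation P ∧
            I.outcomeProb π z ∈ stdSimplex ℝ I.Outcome ∧
            (∀ (ω : I.Outcome) (σ : Equiv.Perm (Fin n)), I.outcomeProb π z ω ≠ 0 →
              (I.output ω σ).image Sigma.fst ∈ I.feas ∧
              ∀ a ∈ I.output ω σ, a.2 = ω.X a.1) ∧
            ∀ adv : I.Adversary,
              c * (Real.exp (-b) - ε) * (1 - Real.exp (-b)) * I.OPT ≤
                ∑ ω, I.outcomeProb π z ω * I.f (I.output ω (adv ω))) ∧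
        -- the algorithm on an arbitrary instance, after splitting its elements into copies
        (∀ k : (∀ i, I.U i → ℕ+), (∀ i e, I.D i e / (k i e : ℕ) ≤ ε') →
          ∀ (N : ℕ) (z : (I.split k).Elem → ℝ), 0 < N →
            1 / (N : ℝ) ≤ δ (Fintype.card (I.split k).Elem) →
            IsContinuousGreedyOutput (I.split k).f ((I.split k).relaxation P) b N
              (δ (Fintype.card (I.split k).Elem)) z →
            z ∈ b • (I.split k).relaxation P ∧
            (I.split k).outcomeProb π z ∈ stdSimplex ℝ (I.split k).Outcome ∧
            (∀ (ω : (I.split k).Outcome) (σ : Equiv.Perm (Fin n)),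
              (I.split k).outcomeProb π z ω ≠ 0 →
              (I.merge k ((I.split k).output ω σ)).image Sigma.fst ∈ I.feas ∧
              ∀ a ∈ I.merge k ((I.split k).output ω σ), a.2 = (ω.X a.1).1) ∧
            ∀ adv : (I.split k).Adversary,
              c * (Real.exp (-b) - ε) * (1 - Real.exp (-b)) * I.OPT ≤
                ∑ ω, (I.split k).outcomeProb π z ω *
                  I.f (I.merge k ((I.split k).output ω (adv ω)))) := by
  refine ⟨Instance.probBound ε, lt_min (by norm_num) (by linarith), Instance.accuracy ε,
    fun m => by unfold Instance.accuracy; positivity, ?_⟩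
  intro n I h0 hm hs P hP hPd b c hb hc π hπ
  refine ⟨fun hD N z hN hNδ hz => I.algorithm_guarantee hε h0 hm hs hP hPd hb hc π hπ hD hN hNδ hz,
    fun k hk N z hN hNδ hz => ?_⟩
  obtain ⟨h1, h2, h3, h4⟩ := (I.split k).algorithm_guarantee hε (fun _ => h0 _)
    (I.split_monotone k hm) (I.split_isSubmodular k hm hs) hP hPd hb hc π hπ
    (fun i a => hk i a.1) hN hNδ hz
  rw [I.split_OPT k] at h4
  -- The split objective is by definition `I.f` of the merged set, so `h4` is already the required
  -- bound.
  refine ⟨h1, h2, fun ω σ hω => ⟨?_, ?_⟩, h4⟩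
  · have h := (h3 ω σ hω).1
    rw [Instance.merge, Finset.image_image]
    exact h
  · intro a ha
    obtain ⟨a', ha', rfl⟩ := Finset.mem_image.1 ha
    exact congrArg Sigma.fst ((h3 ω σ hω).2 a' ha')
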